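/- Let $L$ be a first-order language, $\kappa$ a cardinal with $\kappa>|L|+\aleph_0$, and $\bar M$ a $\kappa$-saturated $L$-structure (for instance a monster model of a complete theory $T$). Call a set small if its cardinality is $<\kappa$. A global type $\mathfrak p(\bar x)$ is a complete type over $\bar M$ in a finite tuple of variables; $\mathfrak p_{\upharpoonright A}$ is its restriction to $A\subseteq\bar M$; $\mathfrak p$ is non-algebraic if every formula in it has infinitely many solutions in $\bar M$. A global type $\mathfrak p$ is $A$-invariant if, whenever finite tuples $\bar b_1,\bar b_2$ of $\bar M$ have the same type over $A$, then $(\phi(\bar x,\bar b_1)\Leftrightarrow\phi(\bar x,\bar b_2))\in\mathfrak p$ for every formula $\phi(\bar x,\bar y)$ over $A$. A sequence $(\bar a_i\mid i<\alpha)$ in $\bar M$ is a Morley sequence in $\mathfrak p$ over $A$ if $\bar a_i\models\mathfrak p_{\upharpoonright A\bar a_{<i}}$ for all $i<\alpha$. A non-algebraic global type $\mathfrak p$ is: - regular if there is a small $A$ such that $\mathfrak p$ is $A$-invariant and for every small $B\supseteq A$ and every $\bar a\models\mathfrak p_{\upharpoonright A}$ in $\bar M$, either $\bar a\models\mathfrak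 p_{\upharpoonright B}$ or $\mathfrak p_{\upharpoonright B}\vdash\mathfrak p_{\upharpoonright B\bar a}$ (that is, every realization of $\mathfrak p_{\upharpoonright B}$ in $\bar M$ realizes $\mathfrak p_{\upharpoonright B\bar a}$); - generically stable if there is a small $A$ such that $\mathfrak p$ is $A$-invariant and for every infinite ordinal $\alpha$, every Morley sequence $(\bar a_i\mid i<\alpha)$ in $\mathfrak p$ over $A$, and every formula $\phi(\bar x)$ with parameters from $\bar M$, the set $\{i<\alpha \mid\ \models\phi(\bar a_i)\}$ is finite or co-finite in $\alpha$. Global types $\mathfrak p(\bar x)$ and $\mathfrak q(\bar y)$ (in disjoint tuples of variables, possibly of different lengths) are orthogonal, $\mathfrak p\perp\mathfrak q$, if $\mathfrak p(\bar x)\cup\mathfrak q(\bar y)$ determines a complete global type, i.e. has exactly one extension to a complete type over $\bar M$ in the variables $\bar x\bar y$. Then: (1) If $\mathfrak p$ and $\mathfrak q$ are regular global types with $\mathfrak p\not\perp\mathfrak q$, then $\mathfrak p$ is generically stable if and only if $\mathfrak q$ is generically stable. (2) Non-orthogonality $\not\perp$ is an equivalence relation on the set of all regular, generically stable global types. -/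

import Mathlib

universe u v w x y

namespace GlobalTypes

open scoped FirstOrder
open FirstOrder.Language

/-- `M` is `κ`-saturated: if `A ⊆ M` has fewer than `κ` elements, every set of formulas over `A`
in finitely many variables that is finitely satisfiable in `M` is realized in `M`. -/
def IsSaturated (L : FirstOrder.Language.{u, v}) (M : Type w) [L.Structure M] (κ : Cardinal.{w}) : Prop :=
  ∀ A : Set M, Cardinal.mk A < κ → ∀ (n : ℕ) (Γ : Set (L[[A]].Formula (Fin n))),
    (∀ Δ : Finset (L[[A]].Formula (Fin n)), (Δ : Set (L[[A]].Formula (Fin n))) ⊆ Γ →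
      ∃ a : Fin n → M, ∀ φ ∈ Δ, φ.Realize a) →
    ∃ a : Fin n → M, ∀ φ ∈ Γ, φ.Realize a

/-- Global types in the variables `α`: complete types over all of `M`. -/
abbrev GlobalType (L : FirstOrder.Language.{u, v}) (M : Type w) [L.Structure M] (α : Type x) :=
  (L.elementaryDiagram M).CompleteType α

variable {L : FirstOrder.Language.{u, v}} {M : Type w} [L.Structure M] {α : Type x} {β : Type y}

/-- The formula `φ`, with parameters from `M`, belongs to the global type `p`. -/
def Has (p : GlobalType L M α) (φ : L[[M]].Formula α) : Prop :=
  Formula.equivSentence φ ∈ p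

/-- A formula with parameters from `A`, seen as a formula with parameters from `M`. -/
def liftParams {A : Set M} (φ : L[[A]].Formula α) : L[[M]].Formula α :=
  (L.lhomWithConstantsMap (Subtype.val : A → M)).onFormula φ

/-- The formula `φ(x, b)` obtained from `φ(x, y)` by substituting the tuple `b` for `y`. -/
def substParams (φ : L[[M]].Formula (α ⊕ β)) (b : β → M) : L[[M]].Formula α :=
  BoundedFormula.subst φ (Sum.elim Term.var fun j => (L.con (b j)).term)

/-- The restriction of a global type to the parameter set `A`. -/
def restrict (p : GlobalType L M α) (A : Set M) : Set (L[[A]].Formula α) :=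
  {φ | Has p (liftParams φ)}

/-- The tuple `a` of `M` realizes the restriction of `p` to `A`. -/
def Realizes (p : GlobalType L M α) (A : Set M) (a : α → M) : Prop :=
  ∀ φ ∈ restrict p A, φ.Realize a

/-- `b₁ ≡ b₂ (A)`: the two tuples have the same type over `A`. -/
def SameType (A : Set M) (b₁ b₂ : β → M) : Prop :=
  ∀ ψ : L[[A]].Formula β, ψ.Realize b₁ ↔ ψ.Realize b₂

/-- `p` is `A`-invariant. -/
def IsInvariant (p : GlobalType L M α) (A : Set M) : Prop :=
  ∀ (k : ℕ) (b₁ b₂ : Fin k → M), SameType (L := L) A b₁ b₂ →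
    ∀ φ : L[[A]].Formula (α ⊕ Fin k),
      Has p ((substParams (liftParams φ) b₁).iff (substParams (liftParams φ) b₂))

/-- `p` is non-algebraic: every formula in `p` has infinitely many solutions. -/
def IsNonalgebraic (p : GlobalType L M α) : Prop :=
  ∀ φ : L[[M]].Formula α, Has p φ → {a : α → M | φ.Realize a}.Infinite

/-- `p` is regular over `A`, where "small" means "of cardinality `< κ`". The relation
`p↾B ⊢ p↾Ba` says that every realization of `p↾B` in `M` realizes `p↾Ba`. -/
def IsRegularOver (κ : Cardinal.{w}) (p : GlobalType L M α) (A : Set M) : Prop :=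
  IsNonalgebraic p ∧ IsInvariant p A ∧
    ∀ B : Set M, A ⊆ B → Cardinal.mk B < κ → ∀ a : α → M, Realizes p A a →
      Realizes p B a ∨
        ∀ a' : α → M, Realizes p B a' → Realizes p (B ∪ Set.range a) a'

/-- `p` is regular: it is regular over some small set. -/
def IsRegular (κ : Cardinal.{w}) (p : GlobalType L M α) : Prop :=
  ∃ A : Set M, Cardinal.mk A < κ ∧ IsRegularOver κ p A

/-- `(aᵢ)` is a Morley sequence in `p` over `A`: each `aᵢ` realizes `p↾A a_{<i}`. -/
def IsMorley {ι : Type y} [LT ι] (p : GlobalType L M α) (A : Set M) (a : ι → α → M) : Prop :=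
  ∀ i, Realizes p (A ∪ ⋃ (j) (_ : j < i), Set.range (a j)) (a i)

/-- `p` is generically stable. Morley sequences are indexed by arbitrary infinite ordinals. -/
def IsGenericallyStable (κ : Cardinal.{w}) (p : GlobalType L M α) : Prop :=
  IsNonalgebraic p ∧ ∃ A : Set M, Cardinal.mk A < κ ∧ IsInvariant p A ∧
    ∀ lam : Ordinal.{w}, Ordinal.omega0 ≤ lam → ∀ a : Set.Iio lam → α → M, IsMorley p A a →
      ∀ φ : L[[M]].Formula α,
        {i | φ.Realize (a i)}.Finite ∨ {i | ¬ φ.Realize (a i)}.Finite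

/-- `p` and `q` are orthogonal: `p(x) ∪ q(y)` determines a complete global type. -/
def Orthogonal (p : GlobalType L M α) (q : GlobalType L M β) : Prop :=
  ∃! r : GlobalType L M (α ⊕ β),
    (∀ φ : L[[M]].Formula α, Has p φ → Has r (φ.relabel Sum.inl)) ∧
    (∀ ψ : L[[M]].Formula β, Has q ψ → Has r (ψ.relabel Sum.inr))

end GlobalTypes

/-! A global type is replaced by the filter its formulas generate, and realizing its restriction to
`A` becomes `Generic` over `A`. Non-orthogonality of `p` and `q` yields a definable relation `R`,
consistent with `p(x) ∪ q(y)`, that never holds between a generic `b` of `q` and an `a` generic over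
`b` (`exists_linked`). Call `a` and `b` linked if `R` holds of them. When `p` is generically stable,
independence between generics of `p` and of `q` is symmetric (`generic_comm_iff`), so linked
generics depend on each other in both directions; regularity then lets a dependent element be added
to a base without harming generics over that base.

The heart is `not_generic_trans`: if `b` is generic over the base but not over `C`, every `a` linked
to `b` is not generic over `C`. Otherwise `a` would also be linked to some `b'` generic over `C`,
hence over `b`, which `not_generic_of_common_left` forbids: it would give a Morley sequence in `p`
inside the fibre of `R` over `b`, putting that fibre in `p`.

For (1), a Morley sequence in `q` inside a definable `S ∉ q` is linked to a Morley sequence in `p`,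
which lies in a set of elements linked to `S`; compactness and `not_generic_trans` keep this set out
of `p`, contradicting stability of `p`. For (2), only transitivity is hard: if `p` and `r` were
orthogonal, independent generics `a`, `d` of them would be linked through a common `b`; then `b`
depends on `d`, hence so does `a`. -/

namespace GlobalTypes

open FirstOrder FirstOrder.Language Set Filter

/-! ### Definable sets, their fibres, and equality of types -/

section Definability

variable {L : FirstOrder.Language.{u, v}} {M : Type w} [L.Structure M] {α : Type x} {β : Type y}

/-- The fibre over `b` of a set of tuples indexed by `α ⊕ β`. -/
def slice (T : Set (α ⊕ β → M)) (b : β → M) : Set (α → M) := {x | Sum.elim x b ∈ T}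

@[simp]
theorem mem_slice {T : Set (α ⊕ β → M)} {b : β → M} {x : α → M} :
    x ∈ slice T b ↔ Sum.elim x b ∈ T := Iff.rfl

theorem definable_slice {A : Set M} {T : Set (α ⊕ β → M)} (hT : A.Definable L T) (b : β → M) :
    (A ∪ range b).Definable L (slice T b) := by
  rw [definable_iff_exists_formula_sum] at hT ⊢
  obtain ⟨φ, rfl⟩ := hT
  refine ⟨φ.relabel (Sum.elim (fun c : A => Sum.inl ⟨c, Or.inl c.2⟩)
    (Sum.elim Sum.inr fun j => Sum.inl ⟨b j, Or.inr ⟨j, rfl⟩⟩)), ?_⟩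
  ext v
  simp only [mem_slice, mem_ofPred_eq, Formula.realize_relabel]
  refine iff_of_eq (congrArg _ ?_)
  funext i
  rcases i with i | i | i <;> rfl

/-- Parameters from `b` are turned back into variables. With `definable_slice` this identifies sets
definable over `A` and `b` with fibres over `b` of `A`-definable sets. -/
theorem exists_slice_eq {A : Set M} {b : β → M} {S : Set (α → M)}
    (hS : (A ∪ range b).Definable L S) :
    ∃ T : Set (α ⊕ β → M), A.Definable L T ∧ slice T b = S := by
  classical
  rw [definable_iff_exists_formula_sum] at hS
  obtain ⟨φ, rfl⟩ := hS
  have h : ∀ c : ↥(A ∪ range b), ∃ i : A ⊕ β, Sum.elim (fun c : A => (c : M)) b i = c := by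
    rintro ⟨c, hc | ⟨j, rfl⟩⟩
    exacts [⟨Sum.inl ⟨c, hc⟩, rfl⟩, ⟨Sum.inr j, rfl⟩]
  choose f hf using h
  refine ⟨{v | (φ.relabel (Sum.elim (fun c => Sum.map id Sum.inr (f c))
    (fun i => Sum.inr (Sum.inl i)))).Realize (Sum.elim (fun c : A => (c : M)) v)},
    definable_iff_exists_formula_sum.2 ⟨_, rfl⟩, ?_⟩
  ext v
  simp only [mem_slice, mem_ofPred_eq, Formula.realize_relabel]
  refine iff_of_eq (congrArg _ ?_)
  funext i
  rcases i with i | i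
  · simp only [Function.comp_apply, Sum.elim_inl]
    rw [← hf i]
    rcases f i with j | j <;> rfl
  · rfl

theorem exists_fin_slice_eq {C : Set M} {S : Set (α → M)} (hS : C.Definable L S) :
    ∃ (k : ℕ) (c : Fin k → M) (T : Set (α ⊕ Fin k → M)),
      range c ⊆ C ∧ (∅ : Set M).Definable L T ∧ slice T c = S := by
  obtain ⟨F, hF, h⟩ := definable_iff_finitely_definable.1 hS
  have e := F.equivFin.symm
  have hr : range (fun i => (e i : M)) = F := by
    ext m
    refine ⟨?_, fun hm => ⟨e.symm ⟨m, hm⟩, by simp⟩⟩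
    rintro ⟨i, rfl⟩
    exact (e i).2
  have h' : (∅ ∪ range (fun i => (e i : M))).Definable L S := by rwa [empty_union, hr]
  obtain ⟨T, hT, h⟩ := exists_slice_eq h'
  exact ⟨_, _, T, hr ▸ hF, hT, h⟩

theorem definable_proj [Finite α] [Finite β] {A : Set M} {T : Set (α ⊕ β → M)}
    (hT : A.Definable L T) : A.Definable L {x : α → M | ∃ y : β → M, Sum.elim x y ∈ T} := by
  convert hT.image_comp (Sum.inl : α → α ⊕ β) using 1
  ext x
  constructor
  · rintro ⟨y, hy⟩
    exact ⟨_, hy, Sum.elim_comp_inl _ _⟩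
  · rintro ⟨z, hz, rfl⟩
    refine ⟨z ∘ Sum.inr, ?_⟩
    rwa [Sum.elim_comp_inl_inr]

variable (L) in
/-- The tuples `b` and `c` belong to the same `A`-definable sets. -/
def Indisc (A : Set M) (b c : β → M) : Prop :=
  ∀ S : Set (β → M), A.Definable L S → b ∈ S → c ∈ S

namespace Indisc

variable {A B : Set M} {b c : β → M}

theorem symm (h : Indisc L A b c) : Indisc L A c b := fun S hS hc => by
  by_contra hb
  exact h Sᶜ hS.compl hb hc

theorem mono (h : Indisc L B b c) (hAB : A ⊆ B) : Indisc L A b c :=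
  fun S hS => h S (hS.mono hAB)

theorem comp (h : Indisc L A b c) (f : α → β) : Indisc L A (b ∘ f) (c ∘ f) :=
  fun _ hS hb => h _ (hS.preimage_comp f) hb

theorem fst {a a' : α → M} (h : Indisc L A (Sum.elim a b) (Sum.elim a' c)) : Indisc L A a a' := by
  simpa using h.comp Sum.inl

theorem snd {a a' : α → M} (h : Indisc L A (Sum.elim a b) (Sum.elim a' c)) : Indisc L A b c := by
  simpa using h.comp Sum.inr

theorem swap {a a' : α → M} (h : Indisc L A (Sum.elim a b) (Sum.elim a' c)) :
    Indisc L A (Sum.elim b a) (Sum.elim c a') := by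
  convert h.comp Sum.swap using 1 <;> ext i <;> rcases i with i | i <;> rfl

theorem of_union_range {a : α → M} (h : Indisc L (A ∪ range a) b c) :
    Indisc L A (Sum.elim b a) (Sum.elim c a) :=
  fun T hT => h (slice T a) (definable_slice hT a)

end Indisc

end Definability

/-! ### Invariant filters and their generics -/

section Filters

variable {L : FirstOrder.Language.{u, v}} {M : Type w} [L.Structure M] {α : Type x} {β : Type y}

variable (L) in
/-- The tuple `a` lies in every `A`-definable set belonging to the filter `p`. -/
def Generic (p : Filter (α → M)) (A : Set M) (a : α → M) : Prop :=
  ∀ S : Set (α → M), A.Definable L S → S ∈ p → a ∈ S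

theorem Generic.mono {p : Filter (α → M)} {A B : Set M} {a : α → M} (h : Generic L p B a)
    (hAB : A ⊆ B) : Generic L p A a :=
  fun S hS => h S (hS.mono hAB)

variable (L) in
/-- The filter `p` decides every definable set, and membership of the fibres of an `A`-definable
set in `p` depends only on the type over `A` of the parameters. -/
structure InvariantFilter (p : Filter (α → M)) (A : Set M) : Prop where
  neBot : p.NeBot
  mem_or : ∀ S : Set (α → M), (univ : Set M).Definable L S → S ∈ p ∨ Sᶜ ∈ p
  slice_mem : ∀ (k : ℕ) (b c : Fin k → M), Indisc L A b c →
    ∀ T : Set (α ⊕ Fin k → M), A.Definable L T → slice T b ∈ p → slice T c ∈ p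

namespace InvariantFilter

variable {p : Filter (α → M)} {A C : Set M}

theorem compl_mem_of_notMem (hp : InvariantFilter L p A) {S : Set (α → M)}
    (hS : C.Definable L S) (h : S ∉ p) : Sᶜ ∈ p :=
  (hp.mem_or S (hS.mono (subset_univ _))).resolve_left h

theorem notMem_of_compl_mem (hp : InvariantFilter L p A) {S : Set (α → M)}
    (h : Sᶜ ∈ p) : S ∉ p := by
  have := hp.neBot
  intro h'
  exact p.empty_notMem (by simpa using inter_mem h' h)

/-- The finitely many parameters from `C` used by `T` are appended to both tuples; since `b` and `c`
agree over `C`, the longer tuples still agree over `A`. -/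
theorem mono (hp : InvariantFilter L p A) (hAC : A ⊆ C) : InvariantFilter L p C where
  neBot := hp.neBot
  mem_or := hp.mem_or
  slice_mem k b c hbc T hT h := by
    obtain ⟨l, e, T', he, hT', rfl⟩ := exists_fin_slice_eq hT
    let f : (α ⊕ Fin k) ⊕ Fin l → α ⊕ Fin (k + l) :=
      Sum.elim (Sum.map id (Fin.castAdd l)) (Sum.inr ∘ Fin.natAdd k)
    have key : ∀ d : Fin k → M,
        slice ((fun g : α ⊕ Fin (k + l) → M => g ∘ f) ⁻¹' T') (Fin.append d e)
          = slice (slice T' e) d := by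
      intro d
      ext z
      simp only [mem_slice, mem_preimage]
      refine iff_of_eq (congrArg (· ∈ T') ?_)
      funext i
      rcases i with (i | i) | i <;> simp [f]
    rw [← key] at h ⊢
    refine hp.slice_mem _ _ _ ?_ _ ((hT'.mono (empty_subset _)).preimage_comp f) h
    have h1 := (Indisc.of_union_range (a := e) (hbc.mono (union_subset hAC he)))
    convert h1.comp (finSumFinEquiv.symm) using 1 <;>
    · funext i
      refine Fin.addCases (fun i => ?_) (fun i => ?_) i <;> simp

theorem slice_mem_of_finite [Finite β] (hp : InvariantFilter L p A) {b c : β → M}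
    (h : Indisc L A b c) {T : Set (α ⊕ β → M)} (hT : A.Definable L T) (hb : slice T b ∈ p) :
    slice T c ∈ p := by
  obtain ⟨k, ⟨e⟩⟩ := Finite.exists_equiv_fin β
  have key : ∀ d : β → M,
      slice ((fun g : α ⊕ Fin k → M => g ∘ Sum.map id e) ⁻¹' T) (d ∘ e.symm) = slice T d := by
    intro d
    ext z
    simp only [mem_slice, mem_preimage]
    refine iff_of_eq (congrArg (· ∈ T) ?_)
    funext i
    rcases i with i | i <;> simp
  rw [← key] at hb ⊢
  exact hp.slice_mem k _ _ (h.comp _) _ (hT.preimage_comp _) hb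

theorem indisc_of_generic (hp : InvariantFilter L p A) {a a' : α → M} (ha : Generic L p C a)
    (ha' : Generic L p C a') : Indisc L C a a' := by
  intro S hS h
  by_contra h'
  have : S ∉ p := fun hSp => h' (ha' S hS hSp)
  exact ha _ hS.compl (hp.compl_mem_of_notMem hS this) h

theorem generic_of_indisc {a a' : α → M} (ha : Generic L p C a)
    (h : Indisc L C a a') : Generic L p C a' :=
  fun S hS hp => h S hS (ha S hS hp)

/-- The type over `A` of a pair consisting of `b` and of a generic over `b` is determined by the
type of `b`. -/
theorem indisc_elim [Finite β] (hp : InvariantFilter L p A) {a a' : α → M} {b b' : β → M}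
    (hb : Indisc L A b b') (ha : Generic L p (A ∪ range b) a)
    (ha' : Generic L p (A ∪ range b') a') :
    Indisc L A (Sum.elim a b) (Sum.elim a' b') := by
  intro T hT h
  by_contra h'
  have h1 : slice T b' ∉ p := fun hm => h' (ha' _ (definable_slice hT b') hm)
  have h2 := hp.slice_mem_of_finite hb.symm hT.compl
    (hp.compl_mem_of_notMem (definable_slice hT b') h1)
  exact ha _ (definable_slice hT.compl b) h2 h

/-- Being generic over `b` depends only on the type of the pair over `A`: invariance carries a fibre
in `p` from `b'` back to `b`. -/
theorem generic_of_indisc_elim [Finite β] (hp : InvariantFilter L p A) {a a' : α → M}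
    {b b' : β → M} (ha : Generic L p (A ∪ range b) a)
    (h : Indisc L A (Sum.elim a b) (Sum.elim a' b')) : Generic L p (A ∪ range b') a' := by
  intro S hS hm
  obtain ⟨T, hT, rfl⟩ := exists_slice_eq hS
  exact h T hT (ha _ (definable_slice hT b) (hp.slice_mem_of_finite h.snd.symm hT hm))

end InvariantFilter

end Filters

/-! ### Compactness and homogeneity from saturation -/

section Saturation

variable {L : FirstOrder.Language.{u, v}} {M : Type w} [L.Structure M] {κ : Cardinal.{w}}
  {α β γ : Type}

theorem IsSaturated.exists_generic [Finite α] (hM : IsSaturated L M κ) {A : Set M}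
    (hA : Cardinal.mk A < κ) (p : Filter (α → M)) [p.NeBot] : ∃ a, Generic L p A a := by
  obtain ⟨n, ⟨e⟩⟩ := Finite.exists_equiv_fin α
  obtain ⟨a, ha⟩ := hM A hA n {φ | {v : α → M | φ.Realize (v ∘ e.symm)} ∈ p} (by
    intro Δ hΔ
    have : ∀ᶠ v in p, ∀ φ ∈ Δ, φ.Realize (v ∘ e.symm) :=
      (Filter.eventually_all_finset Δ).2 fun φ hφ => hΔ hφ
    obtain ⟨v, hv⟩ := this.exists
    exact ⟨_, hv⟩)
  refine ⟨a ∘ e, ?_⟩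
  rintro S ⟨φ, rfl⟩ hS
  have h := ha (φ.relabel e) (by
    simpa only [mem_ofPred_eq, Formula.realize_relabel, Function.comp_assoc, Equiv.symm_comp_self,
      Function.comp_id] using hS)
  simpa using h

/-- One-step homogeneity. The fibres over `b'` of the `A`-definable sets containing `(a, b)` are
nonempty because the projection of such a set is `A`-definable and contains `b`, hence `b'`. -/
theorem IsSaturated.exists_indisc [Finite α] [Finite β] (hM : IsSaturated L M κ)
    (hκ : Cardinal.aleph0 < κ) {A : Set M} (hA : Cardinal.mk A < κ) {b b' : β → M}
    (h : Indisc L A b b') (a : α → M) :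
    ∃ a' : α → M, Indisc L A (Sum.elim a b) (Sum.elim a' b') := by
  let G : Filter (α → M) :=
    { sets := {S | ∃ T : Set (α ⊕ β → M), A.Definable L T ∧ Sum.elim a b ∈ T ∧ slice T b' ⊆ S}
      univ_sets := ⟨univ, definable_univ, mem_univ _, subset_univ _⟩
      sets_of_superset := fun ⟨T, h1, h2, h3⟩ hS => ⟨T, h1, h2, h3.trans hS⟩
      inter_sets := fun ⟨T, h1, h2, h3⟩ ⟨T', h1', h2', h3'⟩ =>
        ⟨T ∩ T', h1.inter h1', ⟨h2, h2'⟩,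
          fun _ hz => ⟨h3 hz.1, h3' hz.2⟩⟩ }
  have : G.NeBot := by
    refine ⟨fun hG => ?_⟩
    obtain ⟨T, hT, hab, hsub⟩ : ∅ ∈ G := by rw [hG]; trivial
    have hd : A.Definable L {y : β → M | ∃ x : α → M, Sum.elim y x ∈
        (fun g : β ⊕ α → M => g ∘ Sum.swap) ⁻¹' T} := definable_proj (hT.preimage_comp _)
    obtain ⟨x, hx⟩ := h _ hd ⟨a, by
      rw [mem_preimage]
      convert hab using 1
      funext i; rcases i with i | i <;> rfl⟩
    refine hsub (show Sum.elim x b' ∈ T from ?_)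
    rw [mem_preimage] at hx
    convert hx using 1
    funext i; rcases i with i | i <;> rfl
  have hA' : Cardinal.mk ↥(A ∪ range b') < κ :=
    (Cardinal.mk_union_le _ _).trans_lt (Cardinal.add_lt_of_lt hκ.le hA
      ((Cardinal.lt_aleph0_of_finite _).trans hκ))
  obtain ⟨a', ha'⟩ := hM.exists_generic hA' G
  exact ⟨a', fun T hT hab => ha' _ (definable_slice hT b') ⟨T, hT, hab, subset_rfl⟩⟩

/-- A definable set meeting every `A`-definable member of `p` contains a generic over `A`. -/
theorem IsSaturated.exists_generic_mem [Finite α] (hM : IsSaturated L M κ) {A C : Set M}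
    (hC : Cardinal.mk C < κ) (hAC : A ⊆ C) (p : Filter (α → M)) {W : Set (α → M)}
    (hW : C.Definable L W)
    (h : ∀ S : Set (α → M), A.Definable L S → S ∈ p → (S ∩ W).Nonempty) :
    ∃ a ∈ W, Generic L p A a := by
  let G : Filter (α → M) :=
    { sets := {S | ∃ T : Set (α → M), A.Definable L T ∧ T ∈ p ∧ T ∩ W ⊆ S}
      univ_sets := ⟨univ, definable_univ, univ_mem, subset_univ _⟩
      sets_of_superset := fun ⟨T, h1, h2, h3⟩ hS => ⟨T, h1, h2, h3.trans hS⟩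
      inter_sets := fun ⟨T, h1, h2, h3⟩ ⟨T', h1', h2', h3'⟩ =>
        ⟨T ∩ T', h1.inter h1', inter_mem h2 h2',
          fun _ hz => ⟨h3 ⟨hz.1.1, hz.2⟩, h3' ⟨hz.1.2, hz.2⟩⟩⟩ }
  have : G.NeBot := by
    refine ⟨fun hG => ?_⟩
    obtain ⟨T, hT, hTp, hsub⟩ : ∅ ∈ G := by rw [hG]; trivial
    obtain ⟨z, hz⟩ := h T hT hTp
    exact hsub hz
  obtain ⟨a, ha⟩ := hM.exists_generic hC G
  refine ⟨a, ha W hW ⟨univ, definable_univ, univ_mem, inter_subset_right⟩, fun S hS hSp => ?_⟩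
  exact ha S (hS.mono hAC) ⟨S, hS, hSp, inter_subset_left⟩

end Saturation

end GlobalTypes

namespace GlobalTypes

open FirstOrder FirstOrder.Language Set Filter

/-! ### Morley sequences and linked pairs of filters -/

section MorleySequences

variable {L : FirstOrder.Language.{u, v}} {M : Type w} [L.Structure M] {κ : Cardinal.{w}}
  {α β : Type}

theorem mk_union_range_lt [Finite β] (hκ : Cardinal.aleph0 < κ) {A : Set M}
    (hA : Cardinal.mk A < κ) (b : β → M) : Cardinal.mk ↥(A ∪ range b) < κ :=
  (Cardinal.mk_union_le _ _).trans_lt (Cardinal.add_lt_of_lt hκ.le hA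
    ((Cardinal.lt_aleph0_of_finite _).trans hκ))

theorem mk_union_lt_of_countable (hκ : Cardinal.aleph0 < κ) {A B : Set M}
    (hA : Cardinal.mk A < κ) (hB : B.Countable) : Cardinal.mk ↥(A ∪ B) < κ :=
  (Cardinal.mk_union_le _ _).trans_lt (Cardinal.add_lt_of_lt hκ.le hA
    ((Cardinal.le_aleph0_iff_set_countable.2 hB).trans_lt hκ))

/-- The set `A` together with the members of the sequence `a` that precede `i`. -/
def before {ι : Type y} [LT ι] (A : Set M) (a : ι → α → M) (i : ι) : Set M :=
  A ∪ ⋃ (j) (_ : j < i), range (a j)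

theorem subset_before {ι : Type y} [LT ι] (A : Set M) (a : ι → α → M) (i : ι) :
    A ⊆ before A a i := subset_union_left

theorem range_subset_before {ι : Type y} [LT ι] (A : Set M) (a : ι → α → M) {i j : ι}
    (h : j < i) : range (a j) ⊆ before A a i :=
  (subset_iUnion₂ (s := fun j (_ : j < i) => range (a j)) j h).trans subset_union_right

theorem before_subset {ι : Type y} [LT ι] {A B : Set M} {a : ι → α → M} {i : ι}
    (hA : A ⊆ B) (h : ∀ j < i, range (a j) ⊆ B) : before A a i ⊆ B :=
  union_subset hA (iUnion₂_subset h)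

@[simp]
theorem before_zero (A : Set M) (a : ℕ → α → M) : before A a 0 = A := by
  simp [before]

theorem before_succ (A : Set M) (a : ℕ → α → M) (n : ℕ) :
    before A a (n + 1) = before A a n ∪ range (a n) := by
  refine (before_subset ?_ ?_).antisymm (union_subset (before_subset ?_ ?_) ?_)
  · exact (subset_before A a n).trans subset_union_left
  · intro j hj
    rcases Nat.lt_succ_iff_lt_or_eq.1 hj with h | rfl
    exacts [(range_subset_before A a h).trans subset_union_left, subset_union_right]
  · exact subset_before _ _ _
  · exact fun j hj => range_subset_before A a (hj.trans n.lt_succ_self)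
  · exact range_subset_before A a n.lt_succ_self

theorem mk_before_lt [Finite α] (hκ : Cardinal.aleph0 < κ) {A : Set M}
    (hA : Cardinal.mk A < κ) (a : ℕ → α → M) (n : ℕ) : Cardinal.mk ↥(before A a n) < κ :=
  mk_union_lt_of_countable hκ hA
    (countable_iUnion fun _ => countable_iUnion fun _ => countable_range _)

variable (L) in
/-- Each member of the sequence `a` is generic over `A` and the preceding members. -/
def Morley {ι : Type y} [LT ι] (p : Filter (α → M)) (A : Set M) (a : ι → α → M) : Prop :=
  ∀ i, Generic L p (before A a i) (a i)

theorem Morley.mono {ι : Type y} [LT ι] {p : Filter (α → M)} {A B : Set M} {a : ι → α → M}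
    (h : Morley L p B a) (hAB : A ⊆ B) : Morley L p A a :=
  fun i => (h i).mono (union_subset_union_left _ hAB)

theorem Morley.comp {ι : Type y} {ι' : Type x} [LT ι] [LT ι'] {p : Filter (α → M)} {A : Set M}
    {a : ι → α → M} (h : Morley L p A a) {f : ι' → ι} (hf : ∀ i j, i < j → f i < f j) :
    Morley L p A (a ∘ f) :=
  fun i => (h (f i)).mono (before_subset (subset_before _ _ _)
    fun j hj => range_subset_before A a (hf j i hj))

theorem Morley.generic {ι : Type y} [LT ι] {p : Filter (α → M)} {A : Set M} {a : ι → α → M}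
    (h : Morley L p A a) (i : ι) : Generic L p A (a i) :=
  (h i).mono (subset_before _ _ _)

theorem IsSaturated.exists_morley [Finite α] (hM : IsSaturated L M κ)
    (hκ : Cardinal.aleph0 < κ) {A : Set M} (hA : Cardinal.mk A < κ) (p : Filter (α → M))
    [p.NeBot] : ∃ a : ℕ → α → M, Morley L p A a := by
  choose g hg using fun B : {B : Set M // Cardinal.mk B < κ} => hM.exists_generic B.2 p
  -- The recursion carries a small set containing `A` and all elements chosen so far.
  let s : ℕ → {B : Set M // Cardinal.mk B < κ} := fun n =>
    Nat.rec ⟨A, hA⟩ (fun _ B => ⟨B ∪ range (g B), mk_union_range_lt hκ B.2 _⟩) n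
  have hs : ∀ n, before A (fun n => g (s n)) n ⊆ (s n).1 := by
    intro n
    induction n with
    | zero => rw [before_zero]; exact subset_rfl
    | succ n ih => rw [before_succ]; exact union_subset_union_left _ ih
  exact ⟨fun n => g (s n), fun n => (hg (s n)).mono (hs n)⟩

variable (L) in
/-- A definable set containing a Morley sequence in `p` over `A` belongs to `p`. -/
def MorleyStable (p : Filter (α → M)) (A : Set M) : Prop :=
  ∀ a : ℕ → α → M, Morley L p A a → ∀ S : Set (α → M), (univ : Set M).Definable L S →
    (∀ n, a n ∈ S) → S ∈ p

theorem MorleyStable.mono {p : Filter (α → M)} {A B : Set M} (h : MorleyStable L p A)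
    (hAB : A ⊆ B) : MorleyStable L p B :=
  fun a ha => h a (ha.mono hAB)

variable (L) in
/-- A realization of `p` over `A` that is not generic over `B ⊇ A` can be added to `B` without
affecting genericity over `B`. -/
def RegularFilter (κ : Cardinal.{w}) (p : Filter (α → M)) (A : Set M) : Prop :=
  ∀ B : Set M, A ⊆ B → Cardinal.mk B < κ → ∀ a : α → M, Generic L p A a → ¬ Generic L p B a →
    ∀ a' : α → M, Generic L p B a' → Generic L p (B ∪ range a) a'

theorem RegularFilter.mono {p : Filter (α → M)} {A B : Set M} (h : RegularFilter L κ p A)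
    (hAB : A ⊆ B) : RegularFilter L κ p B :=
  fun C hC hκ a ha => h C (hAB.trans hC) hκ a (ha.mono hAB)

/-- The set `R` witnesses that `p` and `q` are not orthogonal: it is consistent with `p(x) ∪ q(y)`
and excludes the pairs of a generic of `q` and a generic of `p` over it. -/
structure Linked (L : FirstOrder.Language.{u, v}) [L.Structure M] (κ : Cardinal.{w})
    (p : Filter (α → M)) (q : Filter (β → M)) (A : Set M) (R : Set (α ⊕ β → M)) : Prop where
  definable : A.Definable L R
  exists_pair : ∀ C : Set M, A ⊆ C → Cardinal.mk C < κ →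
    ∃ a b, Generic L p C a ∧ Generic L q C b ∧ Sum.elim a b ∈ R
  notMem : ∀ a b, Generic L q A b → Generic L p (A ∪ range b) a → Sum.elim a b ∉ R

/-- The standing assumptions: `p` and `q` are linked by `R`, both are regular and `p` is stable. -/
structure LinkedRegular (L : FirstOrder.Language.{u, v}) [L.Structure M] (κ : Cardinal.{w})
    (p : Filter (α → M)) (q : Filter (β → M)) (A : Set M) (R : Set (α ⊕ β → M)) : Prop where
  saturated : IsSaturated L M κ
  aleph0_lt : Cardinal.aleph0 < κ
  small : Cardinal.mk A < κ
  inv_left : InvariantFilter L p A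
  inv_right : InvariantFilter L q A
  regular_left : RegularFilter L κ p A
  regular_right : RegularFilter L κ q A
  stable : MorleyStable L p A
  linked : Linked L κ p q A R

namespace LinkedRegular

variable {p : Filter (α → M)} {q : Filter (β → M)} {A C : Set M} {R : Set (α ⊕ β → M)}

theorem not_generic_left (h : LinkedRegular L κ p q A R) {a : α → M} {b : β → M}
    (hb : Generic L q A b) (hab : Sum.elim a b ∈ R) : ¬ Generic L p (A ∪ range b) a :=
  fun ha => h.linked.notMem a b hb ha hab

theorem mono (h : LinkedRegular L κ p q A R) (hAC : A ⊆ C) (hC : Cardinal.mk C < κ) :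
    LinkedRegular L κ p q C R where
  saturated := h.saturated
  aleph0_lt := h.aleph0_lt
  small := hC
  inv_left := h.inv_left.mono hAC
  inv_right := h.inv_right.mono hAC
  regular_left := h.regular_left.mono hAC
  regular_right := h.regular_right.mono hAC
  stable := h.stable.mono hAC
  linked :=
    { definable := h.linked.definable.mono hAC
      exists_pair := fun D hD => h.linked.exists_pair D (hAC.trans hD)
      notMem := fun a b hb ha => h.linked.notMem a b (hb.mono hAC)
        (ha.mono (union_subset_union_left _ hAC)) }

end LinkedRegular

/-! ### Symmetry of independence for a stable filter -/

variable [Finite α] [Finite β] {p : Filter (α → M)} {q : Filter (β → M)} {A C : Set M}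

/-- Take a Morley sequence `s` in `p` and `b'` generic over all of it; each `(s n, b')` has the type
of `(a, b)`. A set over `b` in `p` omitting `a` has a copy over `b'` that omits all `s n`; stability
expels this copy from `p`, while invariance keeps it there. -/
theorem MorleyStable.generic_comm (hM : IsSaturated L M κ) (hκ : Cardinal.aleph0 < κ)
    (hC : Cardinal.mk C < κ) (hp : InvariantFilter L p C) (hs : MorleyStable L p C)
    (hq : InvariantFilter L q C) {a : α → M} {b : β → M} (ha : Generic L p C a)
    (hb : Generic L q (C ∪ range a) b) : Generic L p (C ∪ range b) a := by
  have := hp.neBot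
  have := hq.neBot
  obtain ⟨s, hs'⟩ := hM.exists_morley hκ hC p
  obtain ⟨b', hb'⟩ := hM.exists_generic (mk_union_lt_of_countable hκ hC
    (countable_iUnion fun n => countable_range (s n))) q
  have key : ∀ n, Indisc L C (Sum.elim a b) (Sum.elim (s n) b') := fun n =>
    (hq.indisc_elim (hp.indisc_of_generic ha (hs'.generic n)) hb
      (hb'.mono (union_subset_union_right _ (subset_iUnion (fun n => range (s n)) n)))).swap
  intro S hS hSp
  obtain ⟨T, hT, rfl⟩ := exists_slice_eq hS
  by_contra hab
  have h1 : slice T b' ∈ p := hp.slice_mem_of_finite (key 0).snd hT hSp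
  have h2 : (slice T b')ᶜ ∈ p := hs s hs' _ ((definable_slice hT b').compl.mono (subset_univ _))
    fun n => key n Tᶜ hT.compl hab
  exact hp.notMem_of_compl_mem h2 h1

theorem MorleyStable.generic_comm_iff (hM : IsSaturated L M κ) (hκ : Cardinal.aleph0 < κ)
    (hC : Cardinal.mk C < κ) (hp : InvariantFilter L p C) (hs : MorleyStable L p C)
    (hq : InvariantFilter L q C) {a : α → M} {b : β → M} (ha : Generic L p C a)
    (hb : Generic L q C b) : Generic L q (C ∪ range a) b ↔ Generic L p (C ∪ range b) a := by
  refine ⟨hs.generic_comm hM hκ hC hp hq ha, fun h => ?_⟩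
  have := hq.neBot
  obtain ⟨b', hb'⟩ := hM.exists_generic (mk_union_range_lt hκ hC a) q
  have h' := hs.generic_comm hM hκ hC hp hq ha hb'
  have hbb' := hq.indisc_of_generic (hb'.mono subset_union_left) hb
  exact hq.generic_of_indisc_elim hb' (hp.indisc_elim hbb' h' h).swap

/-! ### Dependence between linked regular types -/

namespace LinkedRegular

variable {R : Set (α ⊕ β → M)}

theorem generic_comm_iff (h : LinkedRegular L κ p q A R) (hAC : A ⊆ C) (hC : Cardinal.mk C < κ)
    {a : α → M} {b : β → M} (ha : Generic L p C a) (hb : Generic L q C b) :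
    Generic L q (C ∪ range a) b ↔ Generic L p (C ∪ range b) a :=
  (h.stable.mono hAC).generic_comm_iff h.saturated h.aleph0_lt hC (h.inv_left.mono hAC)
    (h.inv_right.mono hAC) ha hb

theorem not_generic_right (h : LinkedRegular L κ p q A R) {a : α → M} {b : β → M}
    (ha : Generic L p A a) (hab : Sum.elim a b ∈ R) : ¬ Generic L q (A ∪ range a) b := by
  intro hb
  have hb' : Generic L q A b := hb.mono subset_union_left
  exact h.not_generic_left hb' hab ((h.generic_comm_iff subset_rfl h.small ha hb').1 hb)

/-- Generics over `C` all have the same type over `C`, so a linked pair can be moved onto the given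
`a`. -/
theorem exists_right (h : LinkedRegular L κ p q A R) (hAC : A ⊆ C) (hC : Cardinal.mk C < κ)
    {a : α → M} (ha : Generic L p C a) : ∃ b, Generic L q C b ∧ Sum.elim a b ∈ R := by
  obtain ⟨a', b', ha', hb', hab'⟩ := h.linked.exists_pair C hAC hC
  obtain ⟨b, hb⟩ := h.saturated.exists_indisc h.aleph0_lt hC
    (h.inv_left.indisc_of_generic ha' ha) b'
  exact ⟨b, InvariantFilter.generic_of_indisc hb' hb.fst,
    hb.swap R (h.linked.definable.mono hAC) hab'⟩

theorem exists_left (h : LinkedRegular L κ p q A R) (hAC : A ⊆ C) (hC : Cardinal.mk C < κ)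
    {b : β → M} (hb : Generic L q C b) : ∃ a, Generic L p C a ∧ Sum.elim a b ∈ R := by
  obtain ⟨a', b', ha', hb', hab'⟩ := h.linked.exists_pair C hAC hC
  obtain ⟨a, ha⟩ := h.saturated.exists_indisc h.aleph0_lt hC
    (h.inv_right.indisc_of_generic hb' hb) a'
  exact ⟨a, InvariantFilter.generic_of_indisc ha' ha.fst,
    ha R (h.linked.definable.mono hAC) hab'⟩

/-- Stability of `q` is not yet known, so symmetry is borrowed from `p`: for `a₁` linked to `b` and
`a₀` independent from `b`, the pair `(a₀, a₁)` can be swapped, and `b'` is the image of `b` under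
the swap. -/
theorem exists_symm_pair (h : LinkedRegular L κ p q A R) :
    ∃ b b', Generic L q A b ∧ Generic L q (A ∪ range b) b' ∧ Generic L q (A ∪ range b') b := by
  have := h.inv_left.neBot
  have := h.inv_right.neBot
  have hs : ∀ {δ : Type} [Finite δ] (d : δ → M), Cardinal.mk ↥(A ∪ range d) < κ :=
    fun d => mk_union_range_lt h.aleph0_lt h.small d
  obtain ⟨a₀, ha₀⟩ := h.saturated.exists_generic h.small p
  obtain ⟨b, hb⟩ := h.saturated.exists_generic (hs a₀) q
  have hbA := hb.mono subset_union_left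
  obtain ⟨a₁, ha₁, hab⟩ := h.exists_left subset_rfl h.small hbA
  have h₀ : Generic L p (A ∪ range a₁) a₀ :=
    (h.regular_left _ subset_union_left (hs b) a₁ ha₁ (h.not_generic_left hbA hab) a₀
      ((h.generic_comm_iff subset_rfl h.small ha₀ hbA).1 hb)).mono
      (union_subset_union_left _ subset_union_left)
  have h₁ := h.stable.generic_comm h.saturated h.aleph0_lt h.small h.inv_left h.inv_left ha₁ h₀
  obtain ⟨b', hb'⟩ := h.saturated.exists_indisc h.aleph0_lt h.small
    (h.inv_left.indisc_elim (h.inv_left.indisc_of_generic ha₁ ha₀) h₀ h₁) b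
  have hba₀ : Indisc L A (Sum.elim b a₀) (Sum.elim b' a₁) := by
    convert hb'.comp (Sum.map id Sum.inl) using 1 <;> funext i <;> rcases i with i | i <;> rfl
  have hba₁ : Indisc L A (Sum.elim a₁ b) (Sum.elim a₀ b') := by
    convert hb'.comp (Sum.elim (Sum.inr ∘ Sum.inr) Sum.inl) using 1 <;>
      funext i <;> rcases i with i | i <;> rfl
  have hb'A : Generic L q A b' := InvariantFilter.generic_of_indisc hbA hb'.fst
  have hR := hba₁ R h.linked.definable hab
  refine ⟨b, b', hbA, ?_, ?_⟩
  -- `b` depends on `a₁` and `b'` does not, so regularity makes `b'` generic over `b`; the other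
  -- half exchanges the roles.
  · exact (h.regular_right _ subset_union_left (hs a₁) b hbA (h.not_generic_right ha₁ hab) b'
      (h.inv_right.generic_of_indisc_elim hb hba₀)).mono
      (union_subset_union_left _ subset_union_left)
  · exact (h.regular_right _ subset_union_left (hs a₀) b' hb'A (h.not_generic_right ha₀ hR) b
      hb).mono (union_subset_union_left _ subset_union_left)

/-- All pairs of a generic and a generic over it have the same type, so one symmetric pair suffices.
-/
theorem generic_symm_right (h : LinkedRegular L κ p q A R) (hAC : A ⊆ C)
    (hC : Cardinal.mk C < κ) {b b' : β → M} (hb : Generic L q C b)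
    (hb' : Generic L q (C ∪ range b) b') : Generic L q (C ∪ range b') b := by
  obtain ⟨d, d', hd, hd', hdd'⟩ := (h.mono hAC hC).exists_symm_pair
  have hq := h.inv_right.mono hAC
  exact hq.generic_of_indisc_elim hdd'
    (hq.indisc_elim (hq.indisc_of_generic hd hb) hd' hb').swap

/-- Each earlier `a k` depends on `b k`, which already lies in the base of `a n`; regularity
therefore adds the `a k` to that base one by one. -/
theorem morley_of_not_generic (h : LinkedRegular L κ p q A R) {a : ℕ → α → M} {b : ℕ → β → M}
    (ha : ∀ n, Generic L p (before A b n) (a n)) (hb : ∀ n, Generic L q A (b n))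
    (hab : ∀ n, Sum.elim (a n) (b n) ∈ R) : Morley L p A a := by
  intro n
  have key : ∀ k ≤ n, Generic L p (before (before A b n) a k) (a n) := by
    intro k
    induction k with
    | zero => intro _; rw [before_zero]; exact ha n
    | succ k ih =>
      intro hk
      rw [before_succ]
      have hsub : A ⊆ before A b n := subset_before _ _ _
      refine h.regular_left _ (hsub.trans (subset_before _ _ _))
        (mk_before_lt h.aleph0_lt (mk_before_lt h.aleph0_lt h.small b n) a k) (a k)
        ((ha k).mono (subset_before _ _ _)) (fun hg => ?_) (a n) (ih (by omega))
      exact h.not_generic_left (hb k) (hab k) (hg.mono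
        ((union_subset hsub (range_subset_before A b hk)).trans (subset_before _ _ _)))
  exact (key n le_rfl).mono (union_subset_union_left _ (subset_before _ _ _))

/-- A pair of independent generics of `q` linked to a common generic of `p` over `C` can be found
over `C ∪ range e` as well, if `e` is a generic of `q`. -/
theorem exists_common_left_insert (h : LinkedRegular L κ p q A R) (hAC : A ⊆ C)
    (hC : Cardinal.mk C < κ) {e : β → M} (he : Generic L q C e)
    (hex : ∃ a b b', Generic L p C a ∧ Generic L q C b ∧ Generic L q (C ∪ range b) b' ∧
      Sum.elim a b ∈ R ∧ Sum.elim a b' ∈ R) :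
    ∃ a b b', Generic L p (C ∪ range e) a ∧ Generic L q (C ∪ range e) b ∧
      Generic L q (C ∪ range e ∪ range b) b' ∧ Sum.elim a b ∈ R ∧ Sum.elim a b' ∈ R := by
  obtain ⟨a, b, b', ha, hb, hb', hab, hab'⟩ := hex
  have := h.inv_right.neBot
  have hCb := mk_union_range_lt h.aleph0_lt hC b
  -- With `f` generic over the whole configuration, symmetry makes the configuration generic over
  -- `f`; homogeneity then moves `f` to `e`.
  obtain ⟨f, hf⟩ := h.saturated.exists_generic (mk_union_range_lt h.aleph0_lt
    (mk_union_range_lt h.aleph0_lt hCb b') a) q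
  have hfC : Generic L q C f := hf.mono (by intro x hx; simp [hx])
  have ha₁ : Generic L p (C ∪ range f) a := (h.generic_comm_iff hAC hC ha hfC).1
    (hf.mono (by intro x; simp only [mem_union]; tauto))
  have hb₁ : Generic L q (C ∪ range f) b := h.generic_symm_right hAC hC hb
    (hf.mono (by intro x; simp only [mem_union]; tauto))
  have hb₁' : Generic L q (C ∪ range b ∪ range f) b' :=
    h.generic_symm_right (hAC.trans subset_union_left) hCb hb'
      (hf.mono (by intro x; simp only [mem_union]; tauto))
  obtain ⟨v, hv⟩ := h.saturated.exists_indisc h.aleph0_lt hC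
    (h.inv_right.indisc_of_generic hfC he) (Sum.elim a (Sum.elim b b'))
  obtain ⟨a₂, v, rfl⟩ : ∃ a₂ w, v = Sum.elim a₂ w :=
    ⟨v ∘ Sum.inl, v ∘ Sum.inr, (Sum.elim_comp_inl_inr v).symm⟩
  obtain ⟨b₂, b₂', rfl⟩ : ∃ b₂ w, v = Sum.elim b₂ w :=
    ⟨v ∘ Sum.inl, v ∘ Sum.inr, (Sum.elim_comp_inl_inr v).symm⟩
  have hp := h.inv_left.mono hAC
  have hq := h.inv_right.mono hAC
  have hR := h.linked.definable.mono hAC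
  refine ⟨a₂, b₂, b₂', ?_, ?_, ?_, ?_, ?_⟩
  · refine hp.generic_of_indisc_elim ha₁ ?_
    convert hv.comp (Sum.elim (Sum.inl ∘ Sum.inl) Sum.inr) using 1 <;>
      funext i <;> rcases i with i | i <;> rfl
  · refine hq.generic_of_indisc_elim hb₁ ?_
    convert hv.comp (Sum.elim (Sum.inl ∘ Sum.inr ∘ Sum.inl) Sum.inr) using 1 <;>
      funext i <;> rcases i with i | i <;> rfl
  · have hb₁'' : Generic L q (C ∪ range (Sum.elim f b)) b' := hb₁'.mono (by
      intro x; simp only [Sum.elim_range, mem_union]; tauto)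
    have := hq.generic_of_indisc_elim (b' := Sum.elim e b₂) (a' := b₂') hb₁'' (by
      convert hv.comp (Sum.elim (Sum.inl ∘ Sum.inr ∘ Sum.inr)
        (Sum.elim Sum.inr (Sum.inl ∘ Sum.inr ∘ Sum.inl))) using 1 <;>
      funext i <;> rcases i with i | i | i <;> rfl)
    rwa [Sum.elim_range, ← union_assoc] at this
  · refine (?_ : Indisc L C (Sum.elim a b) (Sum.elim a₂ b₂)) R hR hab
    convert hv.comp (Sum.elim (Sum.inl ∘ Sum.inl) (Sum.inl ∘ Sum.inr ∘ Sum.inl)) using 1 <;>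
      funext i <;> rcases i with i | i <;> rfl
  · refine (?_ : Indisc L C (Sum.elim a b') (Sum.elim a₂ b₂')) R hR hab'
    convert hv.comp (Sum.elim (Sum.inl ∘ Sum.inl) (Sum.inl ∘ Sum.inr ∘ Sum.inr)) using 1 <;>
      funext i <;> rcases i with i | i <;> rfl

/-- Two realizations of `q` linked to the same realization of `p` are dependent. -/
theorem not_generic_of_common_left (h : LinkedRegular L κ p q A R) {a : α → M} {b b' : β → M}
    (ha : Generic L p A a) (hb : Generic L q A b) (hab : Sum.elim a b ∈ R)
    (hab' : Sum.elim a b' ∈ R) : ¬ Generic L q (A ∪ range b) b' := by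
  intro hb'
  have := h.inv_left.neBot
  have := h.inv_right.neBot
  obtain ⟨s, hs⟩ := h.saturated.exists_morley h.aleph0_lt
    (mk_union_range_lt h.aleph0_lt h.small b) q
  have hsmall := mk_before_lt h.aleph0_lt h.small s
  have hsub := fun n => subset_before A s n
  have hsA : Morley L q A s := hs.mono subset_union_left
  have hswap : ∀ n, before (A ∪ range b) s n = before A s n ∪ range b := fun n =>
    union_right_comm _ _ _
  have hbs : ∀ n, Generic L q (before A s n) b := by
    intro n
    induction n with
    | zero => rwa [before_zero]
    | succ n ih =>
      rw [before_succ]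
      exact h.generic_symm_right (hsub n) (hsmall n) ih (hswap n ▸ hs n)
  have hex : ∀ n, ∃ a b b', Generic L p (before A s n) a ∧ Generic L q (before A s n) b ∧
      Generic L q (before A s n ∪ range b) b' ∧ Sum.elim a b ∈ R ∧ Sum.elim a b' ∈ R := by
    intro n
    induction n with
    | zero => rw [before_zero]; exact ⟨a, b, b', ha, hb, hb', hab, hab'⟩
    | succ n ih =>
      rw [before_succ]
      exact h.exists_common_left_insert (hsub n) (hsmall n) (hsA n) ih
  -- The independent pair found over the first `n` terms has the type of `(b, s n)`, so the fixed
  -- `b` can serve for every `n`.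
  have hex' : ∀ n, ∃ c, Generic L p (before A s n) c ∧ Sum.elim c b ∈ R ∧
      Sum.elim c (s n) ∈ R := by
    intro n
    obtain ⟨c, d, d', hc, hd, hd', hcd, hcd'⟩ := hex n
    have hq := h.inv_right.mono (hsub n)
    obtain ⟨c', hc'⟩ := h.saturated.exists_indisc h.aleph0_lt (hsmall n)
      (hq.indisc_elim (hq.indisc_of_generic hd (hbs n)) hd' (hswap n ▸ hs n)) c
    have hR := h.linked.definable.mono (hsub n)
    refine ⟨c', InvariantFilter.generic_of_indisc hc hc'.fst, ?_, ?_⟩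
    · refine (?_ : Indisc L (before A s n) (Sum.elim c d) (Sum.elim c' b)) R hR hcd
      convert hc'.comp (Sum.map id Sum.inr) using 1 <;> funext i <;> rcases i with i | i <;> rfl
    · refine (?_ : Indisc L (before A s n) (Sum.elim c d') (Sum.elim c' (s n))) R hR hcd'
      convert hc'.comp (Sum.map id Sum.inl) using 1 <;> funext i <;> rcases i with i | i <;> rfl
  choose c hc hcb hcs using hex'
  -- The `c n` are linked to the `s n`, hence form a Morley sequence in `p`; all lie in the fibre
  -- over `b`, which no generic of `p` over `b` meets.
  have hmem := h.stable c (h.morley_of_not_generic hc hsA.generic hcs) (slice R b)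
    ((definable_slice h.linked.definable b).mono (subset_univ _)) hcb
  obtain ⟨a', ha'⟩ := h.saturated.exists_generic
    (mk_union_range_lt h.aleph0_lt h.small b) p
  exact h.not_generic_left hb (ha' _ (definable_slice h.linked.definable b) hmem) ha'

/-- A generic `a` over `C` has a linked `b'` generic over `C`. Regularity of `q` makes `b'` generic
over `b`, so `b` and `b'` would be independent with a common link. -/
theorem not_generic_trans (h : LinkedRegular L κ p q A R) (hAC : A ⊆ C) (hC : Cardinal.mk C < κ)
    {a : α → M} {b : β → M} (hb : Generic L q A b) (hab : Sum.elim a b ∈ R)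
    (hbC : ¬ Generic L q C b) : ¬ Generic L p C a := by
  intro ha
  obtain ⟨b', hb', hab'⟩ := h.exists_right hAC hC ha
  exact h.not_generic_of_common_left (ha.mono hAC) hb hab hab'
    ((h.regular_right C hAC hC b hb hbC b' hb').mono (union_subset_union_left _ hAC))

theorem morleyStable_right (h : LinkedRegular L κ p q A R) : MorleyStable L q A := by
  intro b hb S hS hbS
  by_contra hSq
  have := h.inv_left.neBot
  obtain ⟨F, -, hF⟩ := definable_iff_finitely_definable.1 hS
  have hC : Cardinal.mk ↥(A ∪ (F : Set M)) < κ :=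
    mk_union_lt_of_countable h.aleph0_lt h.small F.countable_toSet
  have hSC := hF.mono (subset_union_right : (F : Set M) ⊆ A ∪ F)
  have hd : ∀ T : Set (β → M), A.Definable L T → (A ∪ (F : Set M)).Definable L
      {x : α → M | ∃ y : β → M, Sum.elim x y ∈
        R ∩ (fun g : α ⊕ β → M => g ∘ Sum.inr) ⁻¹' (T ∩ S)} := fun T hT =>
    definable_proj ((h.linked.definable.mono subset_union_left).inter
      (((hT.mono subset_union_left).inter hSC).preimage_comp _))
  -- Some `T ∈ q` must work: otherwise, by compactness, a generic `a` over `C` is linked to a `d ∈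
  -- S` generic over `A`. As `S ∉ q`, this `d` is not generic over `C`, so neither is `a`.
  obtain ⟨T, hT, hTq, hTp⟩ : ∃ T : Set (β → M), A.Definable L T ∧ T ∈ q ∧
      {x : α → M | ∃ y : β → M, Sum.elim x y ∈
        R ∩ (fun g : α ⊕ β → M => g ∘ Sum.inr) ⁻¹' (T ∩ S)} ∉ p := by
    by_contra! hcon
    obtain ⟨a, ha⟩ := h.saturated.exists_generic hC p
    have hR : (A ∪ range a).Definable L {y : β → M | Sum.elim a y ∈ R} := by
      convert definable_slice (h.linked.definable.preimage_comp (Sum.swap : α ⊕ β → β ⊕ α)) a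
        using 1
      ext y
      rw [mem_slice, mem_preimage, mem_ofPred_eq]
      refine iff_of_eq (congrArg (· ∈ R) ?_)
      funext i; rcases i with i | i <;> rfl
    obtain ⟨d, ⟨hdS, hdR⟩, hd'⟩ := h.saturated.exists_generic_mem
      (mk_union_range_lt h.aleph0_lt hC a) (subset_union_left.trans subset_union_left) q
      (W := S ∩ {y : β → M | Sum.elim a y ∈ R})
      ((hSC.mono subset_union_left).inter
        (hR.mono (union_subset_union_left _ subset_union_left))) (by
        intro T hT hTq
        obtain ⟨y, hyR, hyT, hyS⟩ := ha _ (hd T hT) (hcon T hT hTq)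
        exact ⟨y, hyT, hyS, hyR⟩)
    exact h.not_generic_trans subset_union_left hC hd' hdR
      (fun hg => hg _ hSC.compl (h.inv_right.compl_mem_of_notMem hSC hSq) hdS) ha
  choose a ha hab using fun n => h.exists_left (subset_before A b n)
    (mk_before_lt h.aleph0_lt h.small b n) (hb n)
  exact hTp (h.stable a (h.morley_of_not_generic ha hb.generic hab) _
    ((hd T hT).mono (subset_univ _)) fun n =>
      ⟨b n, hab n, hb.generic n T hT hTq, hbS n⟩)

end LinkedRegular

end MorleySequences

end GlobalTypes

namespace GlobalTypes

open FirstOrder FirstOrder.Language Set Filter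

/-! ### Orthogonality as completeness of the box filter -/

section ProductFilter

variable {L : FirstOrder.Language.{u, v}} {M : Type w} [L.Structure M] {κ : Cardinal.{w}}
  {α β γ : Type}

/-- The filter generated by the boxes with sides in `p` and in `q`. -/
def boxFilter (p : Filter (α → M)) (q : Filter (β → M)) : Filter (α ⊕ β → M) :=
  comap (fun v => v ∘ Sum.inl) p ⊓ comap (fun v => v ∘ Sum.inr) q

theorem mem_boxFilter {p : Filter (α → M)} {q : Filter (β → M)} {R : Set (α ⊕ β → M)} :
    R ∈ boxFilter p q ↔ ∃ S ∈ p, ∃ T ∈ q, ∀ a ∈ S, ∀ b ∈ T, Sum.elim a b ∈ R := by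
  constructor
  · intro h
    obtain ⟨U, ⟨S, hS, hSU⟩, V, ⟨T, hT, hTV⟩, rfl⟩ := mem_inf_iff.1 h
    exact ⟨S, hS, T, hT, fun a ha b hb => ⟨hSU (by simpa using ha), hTV (by simpa using hb)⟩⟩
  · rintro ⟨S, hS, T, hT, h⟩
    refine mem_of_superset (inter_mem_inf (preimage_mem_comap hS) (preimage_mem_comap hT)) ?_
    intro v hv
    simpa using h _ hv.1 _ hv.2

instance boxFilter_neBot {p : Filter (α → M)} {q : Filter (β → M)} [p.NeBot] [q.NeBot] :
    (boxFilter p q).NeBot := by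
  refine ⟨fun h => ?_⟩
  obtain ⟨S, hS, T, hT, h'⟩ := mem_boxFilter.1 (h ▸ mem_bot : ∅ ∈ boxFilter p q)
  obtain ⟨a, ha⟩ := Filter.nonempty_of_mem hS
  obtain ⟨b, hb⟩ := Filter.nonempty_of_mem hT
  exact h' a ha b hb

variable (L) in
/-- The filters `p` and `q` together decide every definable set of pairs. -/
def BoxComplete (p : Filter (α → M)) (q : Filter (β → M)) : Prop :=
  ∀ R : Set (α ⊕ β → M), (univ : Set M).Definable L R → R ∈ boxFilter p q ∨ Rᶜ ∈ boxFilter p q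

theorem BoxComplete.symm {p : Filter (α → M)} {q : Filter (β → M)} (h : BoxComplete L p q) :
    BoxComplete L q p := by
  have key : ∀ R : Set (β ⊕ α → M), (fun g : α ⊕ β → M => g ∘ Sum.swap) ⁻¹' R ∈ boxFilter p q →
      R ∈ boxFilter q p := by
    intro R hR
    obtain ⟨S, hS, T, hT, h'⟩ := mem_boxFilter.1 hR
    refine mem_boxFilter.2 ⟨T, hT, S, hS, fun b hb a ha => ?_⟩
    have h₁ := h' a ha b hb
    rw [mem_preimage] at h₁
    convert h₁ using 1
    funext i; rcases i with i | i <;> rfl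
  intro R hR
  exact (h _ (hR.preimage_comp Sum.swap)).imp (key R) (key Rᶜ)

/-- Every member of `p` contains a definable member. -/
def DefinableBasis (L : FirstOrder.Language.{u, v}) [L.Structure M] (p : Filter (α → M)) : Prop :=
  ∀ S ∈ p, ∃ T ∈ p, (univ : Set M).Definable L T ∧ T ⊆ S

/-- The diagonal is undecided: every box meets it, and none lies inside it because members of `p`
are infinite. -/
theorem not_boxComplete_self {p : Filter (α → M)} [Finite α] [p.NeBot]
    (hp : ∀ S ∈ p, S.Infinite) : ¬ BoxComplete L p p := by
  intro h
  have hd : (univ : Set M).Definable L {v : α ⊕ α → M | v ∘ Sum.inl = v ∘ Sum.inr} := by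
    convert definable_iInter_of_finite (f := fun i : α => {v : α ⊕ α → M | v (Sum.inl i) =
      v (Sum.inr i)}) (A := (univ : Set M)) (L := L) fun i =>
        ⟨(Term.var (Sum.inl i)).equal (Term.var (Sum.inr i)), by ext; simp⟩ using 1
    ext v
    simp [funext_iff]
  rcases h _ hd with h' | h'
  · obtain ⟨S, hS, T, hT, h''⟩ := mem_boxFilter.1 h'
    obtain ⟨a, ha, b, hb, hab⟩ := (hp _ (inter_mem hS hT)).nontrivial
    exact hab (by simpa using h'' a ha.1 b hb.2)
  · obtain ⟨S, hS, T, hT, h''⟩ := mem_boxFilter.1 h'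
    obtain ⟨a, ha⟩ := Filter.nonempty_of_mem (inter_mem hS hT)
    exact h'' a ha.1 a ha.2 (by simp)

variable [Finite α] [Finite β] [Finite γ] {p : Filter (α → M)} {q : Filter (β → M)}
  {r : Filter (γ → M)} {A : Set M}

theorem exists_linked (hM : IsSaturated L M κ) (hκ : Cardinal.aleph0 < κ)
    (hA : Cardinal.mk A < κ) (hp : InvariantFilter L p A) (hq : InvariantFilter L q A)
    (h : ¬ BoxComplete L p q) :
    ∃ C : Set M, A ⊆ C ∧ Cardinal.mk C < κ ∧ ∃ R, Linked L κ p q C R := by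
  have := hp.neBot
  have := hq.neBot
  simp only [BoxComplete, not_forall, not_or] at h
  obtain ⟨R, hR, h₁, h₂⟩ := h
  obtain ⟨F, -, hF⟩ := definable_iff_finitely_definable.1 hR
  have hC : Cardinal.mk ↥(A ∪ (F : Set M)) < κ :=
    mk_union_lt_of_countable hκ hA F.countable_toSet
  refine ⟨A ∪ F, subset_union_left, hC, ?_⟩
  obtain ⟨b₀, hb₀⟩ := hM.exists_generic hC q
  obtain ⟨a₀, ha₀⟩ := hM.exists_generic (mk_union_range_lt hκ hC b₀) p
  -- Neither `R` nor its complement contains a box, so whichever omits the independent pair `(a₀,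
  -- b₀)` may be used; invariance makes it omit every such pair.
  obtain ⟨R', hR', h', h₀⟩ : ∃ R' : Set (α ⊕ β → M), (A ∪ (F : Set M)).Definable L R' ∧
      R'ᶜ ∉ boxFilter p q ∧ Sum.elim a₀ b₀ ∉ R' := by
    have hRC := hF.mono (subset_union_right : (F : Set M) ⊆ A ∪ F)
    by_cases h₀ : Sum.elim a₀ b₀ ∈ R
    · exact ⟨Rᶜ, hRC.compl, by rwa [compl_compl], not_not.2 h₀⟩
    · exact ⟨R, hRC, h₂, h₀⟩
  refine ⟨R', hR', ?_, ?_⟩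
  · intro C hAC hC
    have : (boxFilter p q ⊓ 𝓟 R').NeBot := by
      refine ⟨fun hbot => h' ?_⟩
      rw [mem_iff_inf_principal_compl, compl_compl, hbot]
    obtain ⟨v, hv⟩ := hM.exists_generic hC (boxFilter p q ⊓ 𝓟 R')
    refine ⟨v ∘ Sum.inl, v ∘ Sum.inr, ?_, ?_, ?_⟩
    · exact fun S hS hSp => hv _ (hS.preimage_comp Sum.inl)
        (mem_inf_of_left (mem_inf_of_left (preimage_mem_comap hSp)))
    · exact fun S hS hSq => hv _ (hS.preimage_comp Sum.inr)
        (mem_inf_of_left (mem_inf_of_right (preimage_mem_comap hSq)))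
    · rw [Sum.elim_comp_inl_inr]
      exact hv R' (hR'.mono hAC) (mem_inf_of_right (mem_principal_self _))
  · intro a b hb ha hab
    exact h₀ ((hp.mono subset_union_left).indisc_elim
      (hq.indisc_of_generic hb hb₀) ha ha₀ R' hR' hab)

theorem LinkedRegular.not_boxComplete_trans {R : Set (α ⊕ β → M)} {Q : Set (β ⊕ γ → M)}
    (h : LinkedRegular L κ p q A R) (h' : LinkedRegular L κ q r A Q)
    (hp : DefinableBasis L p) (hr : DefinableBasis L r) : ¬ BoxComplete L p r := by
  intro hpr
  have := h.inv_left.neBot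
  have := h.inv_right.neBot
  have := h'.inv_right.neBot
  let Z : Set ((α ⊕ γ) ⊕ β → M) := (fun g => g ∘ Sum.elim (Sum.inl ∘ Sum.inl) Sum.inr) ⁻¹' R ∩
    (fun g => g ∘ Sum.elim Sum.inr (Sum.inl ∘ Sum.inr)) ⁻¹' Q
  have hZd : A.Definable L Z :=
    (h.linked.definable.preimage_comp _).inter (h'.linked.definable.preimage_comp _)
  have hZ : ∀ a b d, Sum.elim (Sum.elim a d) b ∈ Z ↔ Sum.elim a b ∈ R ∧ Sum.elim b d ∈ Q := by
    intro a b d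
    simp only [Z, mem_inter_iff, mem_preimage]
    refine and_congr (iff_of_eq (congrArg (· ∈ R) ?_)) (iff_of_eq (congrArg (· ∈ Q) ?_)) <;>
    · funext i; rcases i with i | i <;> rfl
  have hdef : ∀ X : Set (β → M), A.Definable L X → A.Definable L
      {v : α ⊕ γ → M | ∃ y : β → M, Sum.elim v y ∈ Z ∩ (fun g => g ∘ Sum.inr) ⁻¹' X} :=
    fun X hX => definable_proj (hZd.inter (hX.preimage_comp _))
  -- A member of the box filter contains a box with definable sides, hence every pair of generics
  -- over the parameters of those sides.
  have hbase : ∀ U ∈ boxFilter p r, ∃ C, A ⊆ C ∧ Cardinal.mk C < κ ∧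
      ∀ a d, Generic L p C a → Generic L r C d → Sum.elim a d ∈ U := by
    intro U hU
    obtain ⟨S, hS, T, hT, hST⟩ := mem_boxFilter.1 hU
    obtain ⟨S', hS', hSd, hSS⟩ := hp S hS
    obtain ⟨T', hT', hTd, hTT⟩ := hr T hT
    obtain ⟨F, -, hF⟩ := definable_iff_finitely_definable.1 hSd
    obtain ⟨G, -, hG⟩ := definable_iff_finitely_definable.1 hTd
    refine ⟨A ∪ (F ∪ G), subset_union_left, mk_union_lt_of_countable h.aleph0_lt h.small
      (F.countable_toSet.union G.countable_toSet), fun a d ha hd => ?_⟩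
    exact hST a (hSS (ha S' (hF.mono (subset_union_left.trans subset_union_right)) hS')) d
      (hTT (hd T' (hG.mono (subset_union_right.trans subset_union_right)) hT'))
  -- The complement cannot contain a box: a generic `b` of `q` over a large base has linked generics
  -- of `p` and `r` on either side.
  have hmem : ∀ X : Set (β → M), A.Definable L X → X ∈ q →
      {v : α ⊕ γ → M | ∃ y : β → M, Sum.elim v y ∈ Z ∩ (fun g => g ∘ Sum.inr) ⁻¹' X} ∈
        boxFilter p r := by
    intro X hX hXq
    refine (hpr _ ((hdef X hX).mono (subset_univ _))).resolve_right fun hcon => ?_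
    obtain ⟨C, hAC, hC, hCU⟩ := hbase _ hcon
    obtain ⟨b, hb⟩ := h.saturated.exists_generic hC q
    obtain ⟨a, ha, hab⟩ := h.exists_left hAC hC hb
    obtain ⟨d, hd, hbd⟩ := h'.exists_right hAC hC hb
    exact hCU a d ha hd ⟨b, (hZ a b d).2 ⟨hab, hbd⟩, hb X (hX.mono hAC) hXq⟩
  obtain ⟨d, hd⟩ := h.saturated.exists_generic h.small r
  obtain ⟨a, ha⟩ := h.saturated.exists_generic (mk_union_range_lt h.aleph0_lt h.small d) p
  -- Compactness merges the witnesses for all `X ∈ q` into one `b`, generic over `A` and linked to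
  -- both `a` and `d`.
  obtain ⟨b, hbW, hb⟩ := h.saturated.exists_generic_mem
    (mk_union_range_lt h.aleph0_lt h.small (Sum.elim a d)) subset_union_left q
    (definable_slice (hZd.preimage_comp (Sum.swap : _ → β ⊕ (α ⊕ γ))) (Sum.elim a d)) (by
      intro X hX hXq
      obtain ⟨C, hAC, hC, hCU⟩ := hbase _ (hmem X hX hXq)
      obtain ⟨d', hd'⟩ := h.saturated.exists_generic hC r
      obtain ⟨a', ha'⟩ := h.saturated.exists_generic (mk_union_range_lt h.aleph0_lt hC d') p
      obtain ⟨y, hyZ, hyX⟩ := h.inv_left.indisc_elim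
        (h'.inv_right.indisc_of_generic (hd'.mono hAC) hd)
        (ha'.mono (union_subset_union_left _ hAC)) ha _ (hdef X hX)
        (hCU a' d' (ha'.mono subset_union_left) hd')
      refine ⟨y, hyX, ?_⟩
      rw [mem_slice, mem_preimage]
      convert hyZ using 1
      funext i; rcases i with i | i <;> rfl)
  have hbZ : Sum.elim a b ∈ R ∧ Sum.elim b d ∈ Q := by
    rw [← hZ]
    rw [mem_slice, mem_preimage] at hbW
    convert hbW using 1
    funext i; rcases i with i | i <;> rfl
  exact h.not_generic_trans subset_union_left (mk_union_range_lt h.aleph0_lt h.small d) hb hbZ.1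
    (h'.not_generic_left hd hbZ.2) ha

end ProductFilter

/-! ### From formulas and global types to definable sets and filters -/

section Translation

variable {L : FirstOrder.Language.{u, v}} {M : Type w} [L.Structure M]

theorem realize_liftParams {α : Type x} {A : Set M} (φ : L[[A]].Formula α) (a : α → M) :
    (liftParams φ).Realize a ↔ φ.Realize a := by
  have : (LHom.constantsOnMap (Subtype.val : A → M)).IsExpansionOn M :=
    constantsOnMap_isExpansionOn rfl
  have : (L.lhomWithConstantsMap (Subtype.val : A → M)).IsExpansionOn M :=
    LHom.sumMap_isExpansionOn _ _ _
  exact LHom.realize_onFormula _ _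

theorem definable_univ_iff {α : Type x} {S : Set (α → M)} :
    (univ : Set M).Definable L S ↔ ∃ φ : L[[M]].Formula α, S = {a | φ.Realize a} := by
  constructor
  · rintro ⟨φ, rfl⟩
    exact ⟨liftParams φ, by ext a; simp [realize_liftParams]⟩
  · rintro ⟨φ, rfl⟩
    let f : M → (univ : Set M) := fun m => ⟨m, trivial⟩
    have : (LHom.constantsOnMap f).IsExpansionOn M := constantsOnMap_isExpansionOn rfl
    have : (L.lhomWithConstantsMap f).IsExpansionOn M := LHom.sumMap_isExpansionOn _ _ _
    exact ⟨(L.lhomWithConstantsMap f).onFormula φ, by ext a; simp⟩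

theorem realize_substParams {α : Type x} {β : Type y} (φ : L[[M]].Formula (α ⊕ β)) (b : β → M)
    (a : α → M) : (substParams φ b).Realize a ↔ φ.Realize (Sum.elim a b) := by
  rw [substParams, Formula.Realize, BoundedFormula.realize_subst]
  refine iff_of_eq (congrArg (fun v => BoundedFormula.Realize φ v _) ?_)
  funext i
  rcases i with i | i
  · rfl
  · exact Term.realize_constants

theorem sameType_iff {β : Type y} {A : Set M} {b c : β → M} :
    SameType (L := L) A b c ↔ Indisc L A b c := by
  constructor
  · rintro h S ⟨ψ, rfl⟩ hb
    exact (h ψ).1 hb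
  · exact fun h ψ => ⟨h _ ⟨ψ, rfl⟩, h.symm _ ⟨ψ, rfl⟩⟩

variable {α : Type x}

theorem exists_model_realize_iff_has (p : GlobalType L M α) :
    ∃ (N : Theory.ModelType.{max u w, v, max u v w x} (L.elementaryDiagram M)) (v : α → N),
      ∀ φ : L[[M]].Formula α, Has p φ ↔ φ.Realize v := by
  obtain ⟨N, v, hv⟩ := Theory.exists_modelType_is_realized_in _ p
  refine ⟨N, v, fun φ => ?_⟩
  rw [Has, ← hv, Theory.CompleteType.formula_mem_typeOf]

theorem has_not_iff (p : GlobalType L M α) (φ : L[[M]].Formula α) :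
    Has p φ.not ↔ ¬ Has p φ :=
  p.not_mem_iff _

theorem has_inf_iff (p : GlobalType L M α) (φ ψ : L[[M]].Formula α) :
    Has p (φ ⊓ ψ) ↔ Has p φ ∧ Has p ψ := by
  obtain ⟨N, v, h⟩ := exists_model_realize_iff_has p
  simp [h]

/-- The type is realized in a model of the elementary diagram; that theory is complete, so the
existential closure of `φ` descends to `M`. -/
theorem Has.exists_realize [Finite α] {p : GlobalType L M α} {φ : L[[M]].Formula α}
    (h : Has p φ) : ∃ a : α → M, φ.Realize a := by
  obtain ⟨N, v, hv⟩ := exists_model_realize_iff_has p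
  let σ : L[[M]].Sentence :=
    Formula.iExs α (φ.relabel (Sum.inr : α → Empty ⊕ α) : L[[M]].Formula (Empty ⊕ α))
  have hN : N ⊨ σ := Formula.realize_iExs.2 ⟨v, by simpa using (hv φ).1 h⟩
  have hM : M ⊨ σ := (realize_iff_of_model_completeTheory M N σ).1 hN
  obtain ⟨a, ha⟩ := Formula.realize_iExs.1 hM
  exact ⟨a, by simpa using ha⟩

theorem Has.mono [Finite α] {p : GlobalType L M α} {φ ψ : L[[M]].Formula α} (h : Has p φ)
    (hφψ : ∀ a : α → M, φ.Realize a → ψ.Realize a) : Has p ψ := by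
  by_contra hψ
  obtain ⟨a, ha⟩ := ((has_inf_iff p φ ψ.not).2 ⟨h, (has_not_iff p ψ).2 hψ⟩).exists_realize
  rw [Formula.realize_inf, Formula.realize_not] at ha
  exact ha.2 (hφψ a ha.1)

/-- The filter generated by the sets of solutions of the formulas in `p`. -/
def toFilter (p : GlobalType L M α) : Filter (α → M) where
  sets := {S | ∃ φ, Has p φ ∧ {a : α → M | φ.Realize a} ⊆ S}
  univ_sets := ⟨⊤, by
    obtain ⟨N, v, h⟩ := exists_model_realize_iff_has p
    simp [h], subset_univ _⟩
  sets_of_superset := fun ⟨φ, h, h'⟩ hS => ⟨φ, h, h'.trans hS⟩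
  inter_sets := fun ⟨φ, h, h'⟩ ⟨ψ, k, k'⟩ => ⟨φ ⊓ ψ, (has_inf_iff p φ ψ).2 ⟨h, k⟩, fun a ha =>
    ⟨h' (Formula.realize_inf.1 ha).1, k' (Formula.realize_inf.1 ha).2⟩⟩

end Translation

end GlobalTypes

namespace GlobalTypes

open FirstOrder FirstOrder.Language Set Filter

/-! ### Dictionary between global types and filters -/

section GlobalFilter

variable {L : FirstOrder.Language.{u, v}} {M : Type w} [L.Structure M] {κ : Cardinal.{w}}
  {α β : Type}

theorem definableBasis_toFilter (p : GlobalType L M α) : DefinableBasis L (toFilter p) :=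
  fun _ ⟨φ, h, h'⟩ => ⟨_, ⟨φ, h, subset_rfl⟩, definable_univ_iff.2 ⟨φ, rfl⟩, h'⟩

theorem mem_or_compl_mem_toFilter (p : GlobalType L M α) {S : Set (α → M)}
    (hS : (univ : Set M).Definable L S) : S ∈ toFilter p ∨ Sᶜ ∈ toFilter p := by
  obtain ⟨φ, rfl⟩ := definable_univ_iff.1 hS
  by_cases h : Has p φ
  · exact Or.inl ⟨φ, h, subset_rfl⟩
  · exact Or.inr ⟨φ.not, (has_not_iff p φ).2 h, fun a ha => Formula.realize_not.1 ha⟩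

theorem IsNonalgebraic.infinite_of_mem {p : GlobalType L M α} (hp : IsNonalgebraic p)
    {S : Set (α → M)} (hS : S ∈ toFilter p) : S.Infinite := by
  obtain ⟨φ, h, h'⟩ := hS
  exact (hp φ h).mono h'

/-- The type is the limit, along an ultrafilter refining `G`, of the types of tuples of `M`. -/
theorem exists_globalType_of_filter [Nonempty M] (G : Filter (α → M)) [G.NeBot] :
    ∃ r : GlobalType L M α, ∀ φ : L[[M]].Formula α, (∀ᶠ v in G, φ.Realize v) → Has r φ := by
  let T := L.elementaryDiagram M
  let U := Ultrafilter.of G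
  refine ⟨⟨{σ | ∀ᶠ v : α → M in (U : Filter (α → M)), σ ∈ T.typeOf v}, ?_, ?_, ?_⟩, ?_⟩
  · exact fun σ hσ => Eventually.of_forall fun v => (T.typeOf v).subset hσ
  · rw [Theory.isSatisfiable_iff_isFinitelySatisfiable]
    intro Δ hΔ
    obtain ⟨v, hv⟩ := ((eventually_all_finset Δ).2 fun σ hσ => hΔ hσ).exists
    exact (T.typeOf v).isMaximal.1.mono hv
  · intro σ
    have h := U.eventually_or.1 (Eventually.of_forall fun v : α → M =>
      (T.typeOf v).mem_or_not_mem σ)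
    exact h
  · intro φ hφ
    have : ∀ᶠ v : α → M in (U : Filter (α → M)), Formula.equivSentence φ ∈ T.typeOf v := by
      filter_upwards [Ultrafilter.of_le G hφ] with v hv
      exact Theory.CompleteType.formula_mem_typeOf.2 hv
    exact this

variable [Finite α] [Finite β]

theorem mem_toFilter_iff {p : GlobalType L M α} {φ : L[[M]].Formula α} :
    {a : α → M | φ.Realize a} ∈ toFilter p ↔ Has p φ :=
  ⟨fun ⟨_, h, h'⟩ => h.mono h', fun h => ⟨φ, h, subset_rfl⟩⟩

instance toFilter_neBot (p : GlobalType L M α) : (toFilter p).NeBot := by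
  refine ⟨fun h => ?_⟩
  obtain ⟨φ, h, h'⟩ : ∅ ∈ toFilter p := h ▸ mem_bot
  obtain ⟨a, ha⟩ := h.exists_realize
  exact h' ha

theorem realizes_iff {p : GlobalType L M α} {A : Set M} {a : α → M} :
    Realizes p A a ↔ Generic L (toFilter p) A a := by
  have key : ∀ φ : L[[A]].Formula α, φ ∈ restrict p A ↔ {a : α → M | φ.Realize a} ∈ toFilter p := by
    intro φ
    rw [show {a : α → M | φ.Realize a} = {a | (liftParams φ).Realize a} by
      ext a; simp [realize_liftParams], mem_toFilter_iff]
    rfl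
  constructor
  · rintro h S ⟨φ, rfl⟩ hS
    exact h φ ((key φ).2 hS)
  · exact fun h φ hφ => h _ ⟨φ, rfl⟩ ((key φ).1 hφ)

theorem isInvariant_iff {p : GlobalType L M α} {A : Set M} :
    IsInvariant p A ↔ InvariantFilter L (toFilter p) A := by
  have key : ∀ (k : ℕ) (b c : Fin k → M) (φ : L[[A]].Formula (α ⊕ Fin k)),
      Has p ((substParams (liftParams φ) b).iff (substParams (liftParams φ) c)) ↔
        {a | a ∈ slice {v | φ.Realize v} b ↔ a ∈ slice {v | φ.Realize v} c} ∈ toFilter p := by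
    intro k b c φ
    rw [← mem_toFilter_iff]
    refine iff_of_eq (congrArg (· ∈ toFilter p) ?_)
    ext a
    simp only [mem_ofPred_eq, mem_slice, Formula.realize_iff, realize_substParams,
      realize_liftParams]
  constructor
  · refine fun h => ⟨inferInstance, fun S => mem_or_compl_mem_toFilter p, ?_⟩
    rintro k b c hbc T ⟨φ, rfl⟩ hb
    filter_upwards [hb, (key k b c φ).1 (h k b c (sameType_iff.2 hbc) φ)] with a ha ha'
    exact ha'.1 ha
  · intro h k b c hbc φ
    rw [key]
    have hT : A.Definable L {v : α ⊕ Fin k → M | φ.Realize v} := ⟨φ, rfl⟩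
    rw [sameType_iff] at hbc
    rcases h.mem_or _ ((definable_slice hT b).mono (subset_univ _)) with hb | hb
    · filter_upwards [hb, h.slice_mem k b c hbc _ hT hb] with a ha ha'
      exact iff_of_true ha ha'
    · filter_upwards [hb, h.slice_mem k b c hbc _ hT.compl hb] with a ha ha'
      exact iff_of_false ha ha'

theorem isMorley_iff {ι : Type y} [LT ι] {p : GlobalType L M α} {A : Set M} {a : ι → α → M} :
    IsMorley p A a ↔ Morley L (toFilter p) A a :=
  forall_congr' fun _ => realizes_iff

theorem IsRegularOver.regularFilter {p : GlobalType L M α} {A : Set M}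
    (h : IsRegularOver κ p A) : RegularFilter L κ (toFilter p) A := by
  intro B hAB hB a ha haB a' ha'
  rw [← realizes_iff] at ha haB ha' ⊢
  exact (h.2.2 B hAB hB a ha).resolve_left haB a' ha'

/-- Extensions of `p ∪ q` correspond to refinements of the box filter: an undecided set yields two
of them, by adding it or its complement. -/
theorem orthogonal_iff [Nonempty M] {p : GlobalType L M α} {q : GlobalType L M β} :
    Orthogonal p q ↔ BoxComplete L (toFilter p) (toFilter q) := by
  let E : GlobalType L M (α ⊕ β) → Prop := fun r =>
    (∀ φ : L[[M]].Formula α, Has p φ → Has r (φ.relabel Sum.inl)) ∧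
    (∀ ψ : L[[M]].Formula β, Has q ψ → Has r (ψ.relabel Sum.inr))
  have hE : ∀ r, E r → toFilter r ≤ boxFilter (toFilter p) (toFilter q) := by
    rintro r ⟨h₁, h₂⟩
    refine le_inf ?_ ?_
    · rintro S ⟨T, ⟨φ, hφ, hφT⟩, hTS⟩
      exact ⟨_, h₁ φ hφ, fun v hv => hTS (hφT (Formula.realize_relabel.1 hv))⟩
    · rintro S ⟨T, ⟨φ, hφ, hφT⟩, hTS⟩
      exact ⟨_, h₂ φ hφ, fun v hv => hTS (hφT (Formula.realize_relabel.1 hv))⟩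
  have hex : ∀ G ≤ boxFilter (toFilter p) (toFilter q), G.NeBot →
      ∃ r, E r ∧ ∀ φ : L[[M]].Formula (α ⊕ β), (∀ᶠ v in G, φ.Realize v) → Has r φ := by
    intro G hG hne
    obtain ⟨r, hr⟩ := exists_globalType_of_filter (L := L) G
    refine ⟨r, ⟨fun φ hφ => hr _ (hG ?_), fun ψ hψ => hr _ (hG ?_)⟩, hr⟩
    · refine mem_inf_of_left ⟨_, mem_toFilter_iff.2 hφ, fun v hv => ?_⟩
      exact Formula.realize_relabel.2 hv
    · refine mem_inf_of_right ⟨_, mem_toFilter_iff.2 hψ, fun v hv => ?_⟩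
      exact Formula.realize_relabel.2 hv
  constructor
  · rintro ⟨r, -, hr⟩ R hR
    by_contra! hcon
    obtain ⟨φ, rfl⟩ := definable_univ_iff.1 hR
    have hne : ∀ S, Sᶜ ∉ boxFilter (toFilter p) (toFilter q) →
        (boxFilter (toFilter p) (toFilter q) ⊓ 𝓟 S).NeBot := by
      refine fun S hS => ⟨fun hbot => hS ?_⟩
      rw [mem_iff_inf_principal_compl, compl_compl, hbot]
    obtain ⟨r₁, hr₁, h₁⟩ := hex _ inf_le_left (hne _ hcon.2)
    obtain ⟨r₂, hr₂, h₂⟩ := hex _ inf_le_left (hne {v | φ.Realize v}ᶜ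
      (by rw [compl_compl]; exact hcon.1))
    have h : r₁ = r₂ := (hr r₁ hr₁).trans (hr r₂ hr₂).symm
    have hφ : Has r₁ φ := h₁ φ (mem_inf_of_right (mem_principal_self _))
    have hφ' : Has r₂ φ.not := h₂ φ.not (mem_inf_of_right fun v hv => Formula.realize_not.2 hv)
    exact (has_not_iff r₂ φ).1 hφ' (h ▸ hφ)
  · intro h
    obtain ⟨r, hr, -⟩ := hex _ le_rfl inferInstance
    refine ⟨r, hr, fun r' hr' => SetLike.ext fun σ => ?_⟩
    obtain ⟨φ, rfl⟩ := Formula.equivSentence.surjective σ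
    change Has r' φ ↔ Has r φ
    rcases h _ (definable_univ_iff.2 ⟨φ, rfl⟩) with h' | h'
    · exact iff_of_true (mem_toFilter_iff.1 (hE r' hr' h')) (mem_toFilter_iff.1 (hE r hr h'))
    · have key : ∀ s, E s → ¬ Has s φ := fun s hs => by
        rw [← has_not_iff, ← mem_toFilter_iff]
        filter_upwards [hE s hs h'] with v hv
        exact Formula.realize_not.2 hv
      exact iff_of_false (key r' hr') (key r hr)

theorem Orthogonal.symm [Nonempty M] {p : GlobalType L M α} {q : GlobalType L M β}
    (h : Orthogonal p q) : Orthogonal q p :=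
  orthogonal_iff.2 (orthogonal_iff.1 h).symm

end GlobalFilter

/-! ### Generic stability in terms of `ω`-sequences, and the conclusions -/

section GenericStability

variable {L : FirstOrder.Language.{u, v}} {M : Type w} [L.Structure M] {κ : Cardinal.{w}}
  {α β γ : Type}

/-- Infinitely many exceptions in a well-order contain an increasing `ω`-subsequence, again Morley,
and stability would put `Sᶜ` in `p`. -/
theorem Morley.finite_notMem {ι : Type y} [LinearOrder ι] [WellFoundedLT ι] {p : Filter (α → M)}
    {A : Set M} {a : ι → α → M} (ha : Morley L p A a) (hinv : InvariantFilter L p A)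
    (hst : MorleyStable L p A) {S : Set (α → M)} (hS : (univ : Set M).Definable L S)
    (hSp : S ∈ p) : {i | a i ∉ S}.Finite := by
  by_contra hinf
  let f := Set.Infinite.natEmbedding _ hinf
  obtain ⟨g, hg | hg⟩ := exists_increasing_or_nonincreasing_subseq (· < ·)
    fun n => (f n : ι)
  · refine hinv.notMem_of_compl_mem (hst _ (ha.comp (f := fun n => (f (g n) : ι)) hg) Sᶜ
      hS.compl fun n => (f (g n)).2) hSp
  · refine (RelEmbedding.natGT (r := ((· < ·) : ι → ι → Prop)) (fun n => (f (g n) : ι))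
      fun n => ?_).not_wellFounded wellFounded_lt
    refine lt_of_le_of_ne (not_lt.1 (hg n (n + 1) n.lt_succ_self)) fun heq => ?_
    have := g.injective (f.injective (Subtype.ext heq))
    omega

variable [Finite α] [Finite β] [Finite γ]

theorem IsGenericallyStable.exists_morleyStable (hM : IsSaturated L M κ)
    (hκ : Cardinal.aleph0 < κ) {p : GlobalType L M α} (h : IsGenericallyStable κ p) :
    ∃ A : Set M, Cardinal.mk A < κ ∧ InvariantFilter L (toFilter p) A ∧
      MorleyStable L (toFilter p) A := by
  obtain ⟨-, A, hA, hinv, hst⟩ := h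
  refine ⟨A, hA, isInvariant_iff.1 hinv, fun a ha S hS haS => ?_⟩
  by_contra hSp
  obtain ⟨F, -, hF⟩ := definable_iff_finitely_definable.1 hS
  have hSc := (mem_or_compl_mem_toFilter p hS).resolve_left hSp
  -- Taken over the parameters of `S` and all of `a`, so that `a'` avoids `S` and prolongs `a` to a
  -- Morley sequence.
  obtain ⟨a', ha'⟩ := hM.exists_morley hκ (mk_union_lt_of_countable hκ hA
    (F.countable_toSet.union (countable_iUnion fun n => countable_range (a n)))) (toFilter p)
  have ha'S : ∀ n, a' n ∉ S := fun n => ha'.generic n Sᶜ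
    (hF.compl.mono (subset_union_left.trans subset_union_right)) hSc
  -- The concatenation has order type `ω + ω`, and both `S` and its complement catch infinitely many
  -- terms. The lift places the index ordinal in the universe of `M`.
  let lt : ULift.{w} ℕ → ULift.{w} ℕ → Prop := (· < ·)
  let e := Ordinal.enum (Sum.Lex lt lt)
  let s : ULift.{w} ℕ ⊕ ULift.{w} ℕ → α → M := Sum.elim (a ∘ ULift.down) (a' ∘ ULift.down)
  have hω : Ordinal.omega0 ≤ Ordinal.type (Sum.Lex lt lt) := by
    rw [Ordinal.type_sum_lex]
    have : Ordinal.type lt = Ordinal.omega0.{w} := by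
      simp [lt]
    rw [this]
    exact le_self_add
  have hmor : Morley L (toFilter p) A fun i => s (e i) := by
    intro i
    rcases hi : e i with n | n
    · simp only [hi]
      refine (ha n.down).mono (before_subset (subset_before _ _ _) fun j hj => ?_)
      have hlt := e.map_rel_iff.2 hj
      rw [hi] at hlt
      cases hj' : e j with
      | inl m =>
        rw [hj'] at hlt
        exact range_subset_before A a (Sum.lex_inl_inl.1 hlt : lt m n)
      | inr m =>
        rw [hj'] at hlt
        exact absurd hlt Sum.lex_inr_inl
    · simp only [hi]
      refine (ha' n.down).mono (before_subset
        (subset_union_left.trans (subset_before _ _ _)) fun j hj => ?_)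
      have hlt := e.map_rel_iff.2 hj
      rw [hi] at hlt
      cases hj' : e j with
      | inl m =>
        refine Subset.trans ?_ (subset_before _ _ _)
        exact ((subset_iUnion (fun n => range (a n)) m.down).trans subset_union_right).trans
          subset_union_right
      | inr m =>
        rw [hj'] at hlt
        exact range_subset_before _ a' (Sum.lex_inr_inr.1 hlt : lt m n)
  obtain ⟨φ, rfl⟩ := definable_univ_iff.1 hS
  rcases hst _ hω _ (isMorley_iff.2 hmor) φ with hfin | hfin
  · refine infinite_of_injective_forall_mem (f := fun n : ℕ => e.symm (Sum.inl (ULift.up n)))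
      ?_ (fun n => ?_) hfin
    · intro m n hmn
      exact ULift.up_injective (Sum.inl_injective (e.symm.injective hmn))
    · change s (e (e.symm _)) ∈ {a : α → M | φ.Realize a}
      rw [e.apply_symm_apply]
      exact haS n
  · refine infinite_of_injective_forall_mem (f := fun n : ℕ => e.symm (Sum.inr (ULift.up n)))
      ?_ (fun n => ?_) hfin
    · intro m n hmn
      exact ULift.up_injective (Sum.inr_injective (e.symm.injective hmn))
    · change s (e (e.symm _)) ∉ {a : α → M | φ.Realize a}
      rw [e.apply_symm_apply]
      exact ha'S n

theorem isGenericallyStable_of_morleyStable {p : GlobalType L M α} {A : Set M}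
    (hp : IsNonalgebraic p) (hA : Cardinal.mk A < κ) (hinv : InvariantFilter L (toFilter p) A)
    (hst : MorleyStable L (toFilter p) A) : IsGenericallyStable κ p := by
  refine ⟨hp, A, hA, isInvariant_iff.2 hinv, fun lam _ a ha φ => ?_⟩
  rw [isMorley_iff] at ha
  have hS : (univ : Set M).Definable L {a : α → M | φ.Realize a} :=
    definable_univ_iff.2 ⟨φ, rfl⟩
  rcases mem_or_compl_mem_toFilter p hS with h | h
  · exact Or.inr (ha.finite_notMem hinv hst hS h)
  · exact Or.inl (by simpa using ha.finite_notMem hinv hst hS.compl h)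

variable [Nonempty M]

theorem exists_linkedRegular (hM : IsSaturated L M κ) (hκ : Cardinal.aleph0 < κ)
    {p : GlobalType L M α} {q : GlobalType L M β} (hp : IsRegular κ p) (hq : IsRegular κ q)
    (hs : IsGenericallyStable κ p) (hpq : ¬ Orthogonal p q) :
    ∃ A R, LinkedRegular L κ (toFilter p) (toFilter q) A R := by
  obtain ⟨A₁, hA₁, hp⟩ := hp
  obtain ⟨A₂, hA₂, hq⟩ := hq
  obtain ⟨A₃, hA₃, -, hst⟩ := hs.exists_morleyStable hM hκ
  have hlt : ∀ {X Y : Set M}, Cardinal.mk X < κ → Cardinal.mk Y < κ →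
      Cardinal.mk ↥(X ∪ Y) < κ := fun hX hY =>
    (Cardinal.mk_union_le _ _).trans_lt (Cardinal.add_lt_of_lt hκ.le hX hY)
  have h₁ : A₁ ⊆ A₁ ∪ A₂ ∪ A₃ := fun x hx => Or.inl (Or.inl hx)
  have h₂ : A₂ ⊆ A₁ ∪ A₂ ∪ A₃ := fun x hx => Or.inl (Or.inr hx)
  have h₃ : A₃ ⊆ A₁ ∪ A₂ ∪ A₃ := fun x hx => Or.inr hx
  obtain ⟨C, hAC, hC, R, hR⟩ := exists_linked hM hκ (hlt (hlt hA₁ hA₂) hA₃)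
    ((isInvariant_iff.1 hp.2.1).mono h₁) ((isInvariant_iff.1 hq.2.1).mono h₂)
    (fun h => hpq (orthogonal_iff.2 h))
  exact ⟨C, R, hM, hκ, hC, (isInvariant_iff.1 hp.2.1).mono (h₁.trans hAC),
    (isInvariant_iff.1 hq.2.1).mono (h₂.trans hAC), hp.regularFilter.mono (h₁.trans hAC),
    hq.regularFilter.mono (h₂.trans hAC), hst.mono (h₃.trans hAC), hR⟩

theorem IsGenericallyStable.of_not_orthogonal (hM : IsSaturated L M κ)
    (hκ : Cardinal.aleph0 < κ) {p : GlobalType L M α} {q : GlobalType L M β}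
    (hp : IsRegular κ p) (hq : IsRegular κ q) (hpq : ¬ Orthogonal p q)
    (hs : IsGenericallyStable κ p) : IsGenericallyStable κ q := by
  obtain ⟨A, R, h⟩ := exists_linkedRegular hM hκ hp hq hs hpq
  obtain ⟨-, -, hna, -⟩ := hq
  exact isGenericallyStable_of_morleyStable hna h.small h.inv_right h.morleyStable_right

theorem not_orthogonal_self {p : GlobalType L M α} (hp : IsNonalgebraic p) : ¬ Orthogonal p p :=
  fun h => not_boxComplete_self (fun _ => hp.infinite_of_mem) (orthogonal_iff.1 h)

theorem not_orthogonal_trans (hM : IsSaturated L M κ) (hκ : Cardinal.aleph0 < κ)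
    {p : GlobalType L M α} {q : GlobalType L M β} {r : GlobalType L M γ}
    (hp : IsRegular κ p) (hq : IsRegular κ q) (hr : IsRegular κ r)
    (hps : IsGenericallyStable κ p) (hqs : IsGenericallyStable κ q)
    (hpq : ¬ Orthogonal p q) (hqr : ¬ Orthogonal q r) : ¬ Orthogonal p r := by
  obtain ⟨A, R, h⟩ := exists_linkedRegular hM hκ hp hq hps hpq
  obtain ⟨B, Q, h'⟩ := exists_linkedRegular hM hκ hq hr hqs hqr
  have hlt : Cardinal.mk ↥(A ∪ B) < κ :=
    (Cardinal.mk_union_le _ _).trans_lt (Cardinal.add_lt_of_lt hκ.le h.small h'.small)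
  rw [orthogonal_iff]
  exact (h.mono subset_union_left hlt).not_boxComplete_trans (h'.mono subset_union_right hlt)
    (definableBasis_toFilter p) (definableBasis_toFilter r)

end GenericStability

end GlobalTypes

theorem mainTheorem1 (L : FirstOrder.Language.{u, v}) (M : Type w) [L.Structure M] [Nonempty M]
    (κ : Cardinal.{w}) (hκ : Cardinal.aleph0 < κ)
    (hL : Cardinal.lift.{w} L.card < Cardinal.lift.{max u v} κ)
    (hM : GlobalTypes.IsSaturated L M κ) :
    (∀ (m n : ℕ) (p : GlobalTypes.GlobalType L M (Fin m)) (q : GlobalTypes.GlobalType L M (Fin n)),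
      GlobalTypes.IsRegular κ p → GlobalTypes.IsRegular κ q → ¬ GlobalTypes.Orthogonal p q →
        (GlobalTypes.IsGenericallyStable κ p ↔ GlobalTypes.IsGenericallyStable κ q)) ∧
    Equivalence
      (fun p q : {p : Σ n : ℕ, GlobalTypes.GlobalType L M (Fin n) //
          GlobalTypes.IsRegular κ p.2 ∧ GlobalTypes.IsGenericallyStable κ p.2} =>
        ¬ GlobalTypes.Orthogonal p.1.2 q.1.2) := by
  refine ⟨fun m n p q hp hq hpq => ⟨?_, ?_⟩, ?_, ?_, ?_⟩
  · exact GlobalTypes.IsGenericallyStable.of_not_orthogonal hM hκ hp hq hpq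
  · exact GlobalTypes.IsGenericallyStable.of_not_orthogonal hM hκ hq hp fun h => hpq h.symm
  · exact fun p => GlobalTypes.not_orthogonal_self p.2.2.1
  · exact fun h h' => h h'.symm
  · intro p q r
    exact GlobalTypes.not_orthogonal_trans hM hκ p.2.1 q.2.1 r.2.1 p.2.2 q.2.2
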